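/- Let $(P,\preceq)$ be a finite poset with $n=|P|\ge 2$ elements whose Hasse diagram is connected. A *tube* of $P$ is a subset $\tau\subseteq P$ with $|\tau|\ge 2$ that is convex (if $a,c\in\tau$ and $a\preceq b\preceq c$ then $b\in\tau$) and induces a connected subgraph of the Hasse diagram; it is *proper* if $|\tau|\le n-1$. For disjoint tubes write $\sigma\prec\tau$ if $a\prec b$ for some $a\in\sigma$, $b\in\tau$. A *proper tubing* is a set $T$ of proper tubes such that any two of them are nested or disjoint and there is no cycle $\tau_1\prec\tau_2\prec\dots\prec\tau_k\prec\tau_1$ in $T$. Let $\mathbb R^P_{\Sigma=0}$ be the space of functions $p:P\to\mathbb R$ with $\sum_{i\in P}p_i=0$. For $\tau\subseteq P$ let $$\alpha_\tau(p)=\sum_{i\lessdot j,\ i,j\in\tau}(p_j-p_i),$$ the sum being over all covering relations of $P$ between elements of $\tau$. Then $$A=\{p\in\mathbb R^P_{\Sigma=0}:\ \alpha_P(p)=n^{2|P|}\ \text{ and }\ \alpha_\tau(p)\ge n^{2|\tau|}\text{ for every proper tube }\tau\}$$ is a realization of the poset associahedron $\mathscr A(P)$: it is a nonempty simple convex polytope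 of dimension $n-2$, and the set of its nonempty faces, ordered by inclusion, is isomorphic to the set of proper tubings of $P$ ordered by reverse inclusion. -/

import Mathlib

noncomputable section

namespace PosetAssociahedron

/-! ### Convex polytopes and their faces -/

section Polytope

variable {ι : Type*}

/-- A convex polytope: the convex hull of a finite set of points. -/
def IsConvexPolytope (A : Set (ι → ℝ)) : Prop :=
  ∃ S : Set (ι → ℝ), S.Finite ∧ A = convexHull ℝ S

/-- A nonempty face of `A`: a nonempty set of all the points of `A` at which some linear functional
attains its maximum over `A`. The zero functional gives `A` itself. -/
def IsFace (A F : Set (ι → ℝ)) : Prop :=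
  F.Nonempty ∧ IsExposed ℝ A F

/-- The nonempty faces of `A`; as a subtype of a type of sets it is ordered by inclusion. -/
abbrev Faces (A : Set (ι → ℝ)) : Type _ :=
  {F : Set (ι → ℝ) // IsFace A F}

/-- The dimension of the affine hull of a (nonempty) set. -/
def affDim (A : Set (ι → ℝ)) : ℕ :=
  Module.finrank ℝ (affineSpan ℝ A).direction

/-- A facet of `A`: a nonempty face of dimension `affDim A - 1`. -/
def IsFacet (A F : Set (ι → ℝ)) : Prop :=
  IsFace A F ∧ affDim F + 1 = affDim A

/-- A convex polytope is simple when each of its vertices lies in exactly as many facets as its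
dimension. -/
def IsSimplePolytope (A : Set (ι → ℝ)) : Prop :=
  IsConvexPolytope A ∧
    ∀ v : ι → ℝ, IsFace A {v} → {F : Set (ι → ℝ) | IsFacet A F ∧ v ∈ F}.ncard = affDim A

end Polytope

/-! ### Tubes and proper tubings -/

section Tubings

variable {P : Type*} [PartialOrder P]

/-- A tube: a convex subset with at least two elements which induces a connected subgraph of the
Hasse diagram. -/
def IsTube (τ : Finset P) : Prop :=
  ((SimpleGraph.hasse P).induce (τ : Set P)).Connected ∧
    (∀ a ∈ τ, ∀ c ∈ τ, ∀ b : P, a ≤ b → b ≤ c → b ∈ τ) ∧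
    2 ≤ τ.card

/-- A proper tube: a tube with at most `|P| - 1` elements. -/
def IsProperTube [Fintype P] (τ : Finset P) : Prop :=
  IsTube τ ∧ τ.card < Fintype.card P

/-- The relation `σ ≺ τ` on disjoint tubes. -/
def TubeLT (σ τ : Finset P) : Prop :=
  Disjoint σ τ ∧ ∃ a ∈ σ, ∃ b ∈ τ, a < b

/-- A proper tubing: a set of pairwise nested or disjoint proper tubes, on which the relation `≺`
has no cycle `τ₁ ≺ ⋯ ≺ τₖ ≺ τ₁`. -/
def IsProperTubing [Fintype P] (T : Finset (Finset P)) : Prop :=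
  (∀ τ ∈ T, IsProperTube τ) ∧
    (∀ σ ∈ T, ∀ τ ∈ T, σ ⊆ τ ∨ τ ⊆ σ ∨ Disjoint σ τ) ∧
    ∀ τ, ¬ Relation.TransGen (fun σ ρ : Finset P => σ ∈ T ∧ ρ ∈ T ∧ TubeLT σ ρ) τ τ

variable (P) in
/-- The proper tubings of `P`; as a subtype of a type of finsets it is ordered by inclusion. -/
abbrev ProperTubing [Fintype P] : Type _ :=
  {T : Finset (Finset P) // IsProperTubing T}

end Tubings

/-! ### The half-spaces -/

section Realization

variable {P : Type*} [PartialOrder P] [Fintype P]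

variable (P) in
/-- The space of real functions on `P` that sum to `0`. -/
def zeroSum : Submodule ℝ (P → ℝ) :=
  LinearMap.ker (∑ i : P, LinearMap.proj i : (P → ℝ) →ₗ[ℝ] ℝ)

open Classical in
/-- `α τ p` is the sum of `p j - p i` over all covering relations `i ⋖ j` inside `τ`. -/
def alpha (τ : Finset P) (p : P → ℝ) : ℝ :=
  ∑ i ∈ τ, ∑ j ∈ τ with i ⋖ j, (p j - p i)

/-- The half-space `α_τ ≥ n ^ (2|τ|)` of `zeroSum P`, where `n = |P|`. -/
def halfSpace (τ : Finset P) : Set (P → ℝ) :=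
  {p | p ∈ zeroSum P ∧ (Fintype.card P : ℝ) ^ (2 * τ.card) ≤ alpha τ p}

/-- The hyperplane `α_τ = n ^ (2|τ|)` of `zeroSum P`, where `n = |P|`. -/
def hyperplane (τ : Finset P) : Set (P → ℝ) :=
  {p | p ∈ zeroSum P ∧ alpha τ p = (Fintype.card P : ℝ) ^ (2 * τ.card)}

variable (P) in
/-- The intersection of the hyperplane of `P` with the half-spaces of all proper tubes. -/
def realization : Set (P → ℝ) :=
  hyperplane (Finset.univ : Finset P) ∩ ⋂ τ ∈ {τ : Finset P | IsProperTube τ}, halfSpace τ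

end Realization

end PosetAssociahedron

end

/-! Write `n` for `|P|`. On `A` every tube satisfies its inequality (for `P` itself it is an
equality), and two-element tubes make each `p` in `A` strictly increasing. Then `alpha τ p` is a sum
of nonnegative rises: it is at least the spread of `p` on the connected set `τ` (`sub_le_alpha`),
and at most the number of edges times the largest rise.

Tight sets are tubings. If `U` is joined inside a band of values of `p`, its component in the band
is a tube containing `U`, so the band must be wide: at least `2 n^(2|U|) / (n(n-1))`
(`two_mul_pow_le_of_joinedWithin`). A tight tube `σ` has spread at most `n^(2|σ|)`. Tight tubes that
overlap without nesting, or that form a cycle, have a union strictly larger than each of them, yet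
lying in too narrow a band (`nested_or_disjoint_of_alpha_eq`, `acyclic_of_alpha_eq`).

Tubings are tight sets. Given a tubing together with `P`, a point is built from small tubes to large
ones (`exists_isRealizedBy`). Inside `τ`, contract the maximal smaller tubes; acyclicity orders the
resulting blocks, so they have levels. Adding a multiple of the level to the functions already built
leaves the small tubes unchanged. Choosing the multiple to make `τ` tight makes all tubes that meet
several blocks slack (`exists_stretch`).

Thus the tight sets of points of `A` are exactly the proper tubings, a family closed under taking
subsets. For any polyhedron this gives the face order and the dimensions, and, when it is bounded,
simplicity (`nonempty_faces_orderIso`, `affDim_tightFace`, `isSimplePolytope_polyhedron`). -/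

namespace PosetAssociahedron

/-! ### Faces of a polyhedron read off from its tight sets -/

section Polyhedron

open Set Filter Topology

variable {ι J K : Type*}

/-- The polyhedron given by the equations `g j p = c j` and the inequalities `b k ≤ f k p` for
`k ∈ S`. -/
def polyhedron (g : J → (ι → ℝ) →ₗ[ℝ] ℝ) (c : J → ℝ) (f : K → (ι → ℝ) →ₗ[ℝ] ℝ) (b : K → ℝ)
    (S : Finset K) : Set (ι → ℝ) :=
  {p | (∀ j, g j p = c j) ∧ ∀ k ∈ S, b k ≤ f k p}

open Classical in
/-- The indices of the inequalities that are equalities at `p`. -/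
noncomputable def tightSet (f : K → (ι → ℝ) →ₗ[ℝ] ℝ) (b : K → ℝ) (S : Finset K)
    (p : ι → ℝ) : Finset K :=
  {k ∈ S | f k p = b k}

/-- The points of the polyhedron at which the inequalities with index in `T` are equalities. -/
def tightFace (g : J → (ι → ℝ) →ₗ[ℝ] ℝ) (c : J → ℝ) (f : K → (ι → ℝ) →ₗ[ℝ] ℝ) (b : K → ℝ)
    (S T : Finset K) : Set (ι → ℝ) :=
  {p | p ∈ polyhedron g c f b S ∧ ∀ k ∈ T, f k p = b k}

/-- The directions along which the equations and the equalities with index in `T` persist. -/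
def tightDirection (g : J → (ι → ℝ) →ₗ[ℝ] ℝ) (f : K → (ι → ℝ) →ₗ[ℝ] ℝ) (T : Finset K) :
    Submodule ℝ (ι → ℝ) :=
  LinearMap.ker ((LinearMap.pi g).prod (LinearMap.pi fun k : T => f k))

variable {g : J → (ι → ℝ) →ₗ[ℝ] ℝ} {c : J → ℝ} {f : K → (ι → ℝ) →ₗ[ℝ] ℝ} {b : K → ℝ}
  {S T T' : Finset K} {p q r v : ι → ℝ} {F : Set (ι → ℝ)}

lemma mem_tightSet {k : K} : k ∈ tightSet f b S p ↔ k ∈ S ∧ f k p = b k := by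
  simp [tightSet]

lemma mem_tightFace_iff (hT : T ⊆ S) :
    p ∈ tightFace g c f b S T ↔ p ∈ polyhedron g c f b S ∧ T ⊆ tightSet f b S p :=
  and_congr_right fun _ => ⟨fun h _ hk => mem_tightSet.2 ⟨hT hk, h _ hk⟩,
    fun h _ hk => (mem_tightSet.1 (h hk)).2⟩

lemma mem_tightDirection :
    v ∈ tightDirection g f T ↔ (∀ j, g j v = 0) ∧ ∀ k ∈ T, f k v = 0 := by
  simp [tightDirection, LinearMap.mem_ker, funext_iff]

lemma tightFace_empty : tightFace g c f b S ∅ = polyhedron g c f b S := by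
  simp [tightFace]

lemma convex_polyhedron : Convex ℝ (polyhedron g c f b S) := by
  have : polyhedron g c f b S =
      (⋂ j, {p | g j p = c j}) ∩ ⋂ k ∈ S, {p | b k ≤ f k p} := by
    ext; simp [polyhedron]
  rw [this]
  refine Convex.inter (convex_iInter fun j => convex_hyperplane (g j).isLinear _) ?_
  exact convex_iInter₂ fun k _ => convex_halfSpace_ge (f k).isLinear _

lemma mem_tightFace_tightSet (hp : p ∈ polyhedron g c f b S) :
    p ∈ tightFace g c f b S (tightSet f b S p) :=
  ⟨hp, fun _ hk => (mem_tightSet.1 hk).2⟩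

lemma sub_mem_tightDirection (hp : p ∈ tightFace g c f b S T) (hq : q ∈ tightFace g c f b S T) :
    p - q ∈ tightDirection g f T := by
  rw [mem_tightDirection]
  exact ⟨fun j => by simp [hp.1.1 j, hq.1.1 j], fun k hk => by simp [hp.2 k hk, hq.2 k hk]⟩

lemma tightFace_subset_iff (hp : p ∈ polyhedron g c f b S) (hT : T ⊆ S) :
    tightFace g c f b S (tightSet f b S p) ⊆ tightFace g c f b S T ↔ T ⊆ tightSet f b S p := by
  refine ⟨fun h => ((mem_tightFace_iff hT).1 (h (mem_tightFace_tightSet hp))).2,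
    fun h r hr => ⟨hr.1, fun k hk => hr.2 k (h hk)⟩⟩

/-- Equations and tight inequalities are constant along `v`, and the finitely many slack ones
survive a small move in either direction by continuity. -/
lemma exists_forall_add_smul_mem (hp : p ∈ polyhedron g c f b S)
    (hv : v ∈ tightDirection g f (tightSet f b S p)) :
    ∃ ε > 0, ∀ t : ℝ, |t| ≤ ε → p + t • v ∈ polyhedron g c f b S := by
  rw [mem_tightDirection] at hv
  have key : ∀ᶠ t : ℝ in 𝓝 0, ∀ k ∈ S, b k ≤ f k (p + t • v) := by
    rw [eventually_all_finset]
    intro k hk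
    by_cases htight : f k p = b k
    · refine Eventually.of_forall fun t => ?_
      simp [htight, hv.2 k (mem_tightSet.2 ⟨hk, htight⟩)]
    · have hlt : b k < f k p := lt_of_le_of_ne (hp.2 k hk) (Ne.symm htight)
      have hc : ContinuousAt (fun t : ℝ => f k p + t * f k v) 0 := by fun_prop
      have hlt' : b k < (fun t : ℝ => f k p + t * f k v) 0 := by simpa using hlt
      filter_upwards [hc.eventually (lt_mem_nhds hlt')] with t ht
      simpa using ht.le
  obtain ⟨ε, hε, h⟩ := Metric.eventually_nhds_iff.1 key
  refine ⟨ε / 2, half_pos hε, fun t ht => ⟨fun j => ?_, h ?_⟩⟩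
  · simp [hp.1 j, hv.1 j]
  · rw [Real.dist_eq, sub_zero]
    linarith

lemma isClosed_polyhedron [Finite ι] : IsClosed (polyhedron g c f b S) := by
  have : polyhedron g c f b S =
      (⋂ j, {p | g j p = c j}) ∩ ⋂ k ∈ S, {p | b k ≤ f k p} := by
    ext; simp [polyhedron]
  rw [this]
  refine IsClosed.inter (isClosed_iInter fun j => ?_) (isClosed_biInter fun k _ => ?_)
  · exact isClosed_eq (LinearMap.continuous_of_finiteDimensional _) continuous_const
  · exact isClosed_le continuous_const (LinearMap.continuous_of_finiteDimensional _)

/-- An extreme point is determined by its tight set, and there are finitely many of these. -/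
lemma finite_extremePoints_polyhedron :
    ((polyhedron g c f b S).extremePoints ℝ).Finite := by
  refine Set.Finite.of_finite_image (f := tightSet f b S)
    ((S.powerset.finite_toSet).subset ?_) ?_
  · rintro _ ⟨p, -, rfl⟩
    exact Finset.mem_coe.2 (Finset.mem_powerset.2 fun k hk => (mem_tightSet.1 hk).1)
  · intro p hp q hq hpq
    rw [mem_extremePoints] at hp
    have hq' : q ∈ tightFace g c f b S (tightSet f b S p) := by
      rw [hpq]; exact mem_tightFace_tightSet hq.1
    obtain ⟨ε, hε, h⟩ := exists_forall_add_smul_mem hp.1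
      (sub_mem_tightDirection hq' (mem_tightFace_tightSet hp.1))
    -- If `q` has the same tight set as `p`, the segment from `q` to `p` extends beyond `p`, which
    -- contradicts extremality unless `q = p`.
    have h1 := h (-ε) (by rw [abs_neg, abs_of_pos hε])
    refine ((hp.2 q hq.1 _ h1 ⟨ε / (1 + ε), 1 / (1 + ε), by positivity, by positivity,
      by field_simp; ring, ?_⟩).1).symm
    ext i
    simp
    field_simp
    ring

lemma isConvexPolytope_polyhedron [Finite ι] (hbdd : Bornology.IsBounded (polyhedron g c f b S)) :
    IsConvexPolytope (polyhedron g c f b S) := by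
  refine ⟨_, finite_extremePoints_polyhedron (g := g) (c := c) (f := f) (b := b) (S := S), ?_⟩
  have := Fintype.ofFinite ι
  rw [← (finite_extremePoints_polyhedron.isClosed_convexHull ℝ).closure_eq]
  exact (closure_convexHull_extremePoints
    (Metric.isCompact_of_isClosed_isBounded isClosed_polyhedron hbdd) convex_polyhedron).symm

lemma isFace_tightFace [Finite ι] (hT : T ⊆ S) (hne : (tightFace g c f b S T).Nonempty) :
    IsFace (polyhedron g c f b S) (tightFace g c f b S T) := by
  obtain ⟨q, hq⟩ := hne
  -- Faces are maximizers, so the exposing functional is minus the sum of the inequalities in `T`;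
  -- it is maximal exactly when each of them is tight.
  refine ⟨⟨q, hq⟩, fun _ => ⟨-LinearMap.toContinuousLinearMap (∑ k ∈ T, f k), ?_⟩⟩
  have hle : ∀ p ∈ polyhedron g c f b S, ∑ k ∈ T, b k ≤ ∑ k ∈ T, f k p := fun p hp =>
    Finset.sum_le_sum fun k hk => hp.2 k (hT hk)
  have hq' : ∑ k ∈ T, f k q = ∑ k ∈ T, b k := Finset.sum_congr rfl hq.2
  ext p
  simp only [mem_ofPred_eq, neg_apply, neg_le_neg_iff,
    LinearMap.coe_toContinuousLinearMap', LinearMap.sum_apply]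
  constructor
  · intro hp
    refine ⟨hp.1, fun y hy => ?_⟩
    rw [Finset.sum_congr rfl hp.2]
    exact hle y hy
  · rintro ⟨hp, h⟩
    have heq : ∑ k ∈ T, b k = ∑ k ∈ T, f k p := (hle p hp).antisymm (by simpa [hq'] using h q hq.1)
    rw [Finset.sum_eq_sum_iff_of_le fun k hk => hp.2 k (hT hk)] at heq
    exact ⟨hp, fun k hk => (heq k hk).symm⟩

/-- A point `q` of `F` with fewest tight inequalities is a relative interior point. A midpoint with
`q` is tight only where both ends are, so minimality puts `F` in the tight face of `q`. Conversely,
a segment from the tight face extends beyond `q`, so a functional maximal at `q` is maximal on the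
whole face. -/
lemma exists_eq_tightFace (hF : IsFace (polyhedron g c f b S) F) :
    ∃ q ∈ F, q ∈ polyhedron g c f b S ∧ F = tightFace g c f b S (tightSet f b S q) := by
  have hconv := hF.2.convex convex_polyhedron
  obtain ⟨hne, hexp⟩ := hF
  obtain ⟨l, hl⟩ := hexp hne
  have hFA : F ⊆ polyhedron g c f b S := by rw [hl]; exact fun _ h => h.1
  obtain ⟨q, hq, hmin⟩ : ∃ q ∈ F, ∀ r ∈ F, (tightSet f b S q).card ≤ (tightSet f b S r).card := by
    obtain ⟨m, ⟨q, hq, rfl⟩, hm⟩ := WellFounded.has_min Nat.lt_wfRel.wf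
      ((fun q => (tightSet f b S q).card) '' F) (hne.image _)
    exact ⟨q, hq, fun r hr => not_lt.1 (hm _ ⟨r, hr, rfl⟩)⟩
  refine ⟨q, hq, hFA hq, Subset.antisymm (fun r hr => ?_) fun r hr => ?_⟩
  · have hmid : (1 / 2 : ℝ) • q + (1 / 2 : ℝ) • r ∈ F :=
      hconv hq hr (by norm_num) (by norm_num) (by norm_num)
    have hsub : ∀ k ∈ tightSet f b S ((1 / 2 : ℝ) • q + (1 / 2 : ℝ) • r),
        k ∈ tightSet f b S q ∧ f k r = b k := by
      intro k hk
      rw [mem_tightSet] at hk ⊢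
      have h1 := (hFA hq).2 k hk.1
      have h2 := (hFA hr).2 k hk.1
      have h3 := hk.2
      simp only [map_add, map_smul, smul_eq_mul] at h3
      exact ⟨⟨hk.1, by linarith⟩, by linarith⟩
    have heq := Finset.eq_of_subset_of_card_le (fun k hk => (hsub k hk).1) (hmin _ hmid)
    exact ⟨hFA hr, fun k hk => (hsub k (heq ▸ hk)).2⟩
  · obtain ⟨ε, hε, h⟩ := exists_forall_add_smul_mem (hFA hq)
      (sub_mem_tightDirection hr (mem_tightFace_tightSet (hFA hq)))
    have h1 := h (-ε) (by rw [abs_neg, abs_of_pos hε])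
    have hqmax : ∀ y ∈ polyhedron g c f b S, l y ≤ l q := by
      rw [hl] at hq; exact hq.2
    have h2 := hqmax _ h1
    simp only [map_add, map_smul, map_sub, smul_eq_mul] at h2
    rw [hl]
    refine ⟨hr.1, fun y hy => (hqmax y hy).trans ?_⟩
    nlinarith

lemma vectorSpan_tightFace (hq : q ∈ polyhedron g c f b S) :
    vectorSpan ℝ (tightFace g c f b S (tightSet f b S q)) =
      tightDirection g f (tightSet f b S q) := by
  apply le_antisymm
  · rw [vectorSpan_def, Submodule.span_le]
    rintro _ ⟨x, hx, y, hy, rfl⟩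
    exact sub_mem_tightDirection hx hy
  · intro v hv
    obtain ⟨ε, hε, h⟩ := exists_forall_add_smul_mem hq hv
    have h1 : q + ε • v ∈ tightFace g c f b S (tightSet f b S q) := by
      refine ⟨h ε (abs_of_pos hε).le, fun k hk => ?_⟩
      simp [(mem_tightDirection.1 hv).2 k hk, (mem_tightSet.1 hk).2]
    have h2 := vsub_mem_vectorSpan ℝ h1 (mem_tightFace_tightSet hq)
    have h3 := Submodule.smul_mem _ ε⁻¹ h2
    simpa [smul_smul, hε.ne'] using h3

lemma finrank_tightDirection [Fintype ι] [Fintype J]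
    (hg : Function.Surjective (LinearMap.pi g))
    (hd : ∀ k ∈ T, ∃ d, (∀ j, g j d = 0) ∧ f k d ≠ 0 ∧ ∀ k' ∈ T, k' ≠ k → f k' d = 0) :
    Module.finrank ℝ (tightDirection g f T) + T.card + Fintype.card J = Fintype.card ι := by
  classical
  have hsurj : Function.Surjective
      ((LinearMap.pi g).prod (LinearMap.pi fun k : T => f k)) := by
    rintro ⟨a, y⟩
    obtain ⟨v, hv⟩ := hg a
    choose! d hd1 hd2 hd3 using hd
    -- The vectors `d k` form a dual family, up to scaling: each corrects one coordinate and
    -- disturbs neither the others nor the equations.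
    refine ⟨v + ∑ k : T, ((y k - f k v) / f k (d k)) • d k, ?_⟩
    simp only [LinearMap.prod_apply, Function.prod_apply, Prod.mk.injEq]
    constructor
    · rw [← hv]
      ext j
      have hz : ∀ k : T, ((y k - f k v) / f k (d k)) * g j (d k) = 0 := fun k => by
        rw [hd1 k k.2, mul_zero]
      simp [hz]
    · ext k
      simp only [LinearMap.pi_apply, map_add, map_sum, map_smul, smul_eq_mul]
      rw [Finset.sum_eq_single k]
      · field_simp [hd2 k k.2]
        ring
      · intro k' _ hk'
        rw [hd3 k' k'.2 k k.2 fun h => hk' (Subtype.ext h.symm), mul_zero]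
      · simp
  have h := LinearMap.finrank_range_add_finrank_ker
    ((LinearMap.pi g).prod (LinearMap.pi fun k : T => f k))
  rw [LinearMap.range_eq_top.2 hsurj, finrank_top] at h
  simp only [Module.finrank_prod, Module.finrank_fintype_fun_eq_card, Fintype.card_coe] at h
  rw [tightDirection]
  omega

variable {Tub : Finset K → Prop}

/-- If the sets of inequalities that are tight at a point of a polyhedron are those with the
property `Tub`, then the faces are ordered like these sets, by reverse inclusion. -/
lemma nonempty_faces_orderIso [Finite ι]
    (htight : ∀ p ∈ polyhedron g c f b S, Tub (tightSet f b S p))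
    (hex : ∀ T, Tub T → ∃ p ∈ polyhedron g c f b S, tightSet f b S p = T) :
    Nonempty (Faces (polyhedron g c f b S) ≃o {T : Finset K // Tub T}ᵒᵈ) := by
  have hsub : ∀ T, Tub T → T ⊆ S := by
    rintro T hT k hk
    obtain ⟨p, -, rfl⟩ := hex T hT
    exact (mem_tightSet.1 hk).1
  have hne : ∀ T, Tub T → (tightFace g c f b S T).Nonempty := by
    rintro T hT
    obtain ⟨p, hp, rfl⟩ := hex T hT
    exact ⟨p, mem_tightFace_tightSet hp⟩
  let φ : {T : Finset K // Tub T}ᵒᵈ → Faces (polyhedron g c f b S) := fun T =>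
    ⟨tightFace g c f b S (OrderDual.ofDual T).1,
      isFace_tightFace (hsub _ (OrderDual.ofDual T).2) (hne _ (OrderDual.ofDual T).2)⟩
  have hφ : ∀ T T', φ T ≤ φ T' ↔ T ≤ T' := by
    intro T T'
    change tightFace g c f b S (OrderDual.ofDual T).1 ⊆ tightFace g c f b S (OrderDual.ofDual T').1
      ↔ (OrderDual.ofDual T').1 ⊆ (OrderDual.ofDual T).1
    obtain ⟨p, hp, h⟩ := hex _ (OrderDual.ofDual T).2
    rw [← h]
    exact tightFace_subset_iff hp (hsub _ (OrderDual.ofDual T').2)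
  refine ⟨(RelIso.ofSurjective (OrderEmbedding.ofMapLEIff φ hφ) ?_).symm⟩
  rintro ⟨F, hF⟩
  obtain ⟨q, -, hq, rfl⟩ := exists_eq_tightFace hF
  exact ⟨OrderDual.toDual ⟨_, htight q hq⟩, rfl⟩

/-- Closure under subsets gives a point where only the constraint `k` of `T` is relaxed. Its
difference from `q` is a direction moving `f k` alone, so the constraints in `T` are independent. -/
lemma affDim_tightFace [Fintype ι] [Fintype J]
    (hsub : ∀ T T', Tub T → T' ⊆ T → Tub T')
    (hex : ∀ T, Tub T → ∃ p ∈ polyhedron g c f b S, tightSet f b S p = T)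
    (hg : Function.Surjective (LinearMap.pi g)) (hT : Tub T) :
    affDim (tightFace g c f b S T) + T.card + Fintype.card J = Fintype.card ι := by
  classical
  obtain ⟨q, hq, rfl⟩ := hex T hT
  rw [affDim, direction_affineSpan, vectorSpan_tightFace hq]
  refine finrank_tightDirection hg fun k hk => ?_
  obtain ⟨r, hr, hrT⟩ := hex _ (hsub _ _ hT (Finset.erase_subset k _))
  refine ⟨r - q, fun j => by simp [hr.1 j, hq.1 j], ?_, fun k' hk' hne => ?_⟩
  · rw [map_sub, (mem_tightSet.1 hk).2, sub_ne_zero]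
    intro h
    have : k ∈ tightSet f b S r := mem_tightSet.2 ⟨(mem_tightSet.1 hk).1, h⟩
    simp [hrT] at this
  · have : k' ∈ tightSet f b S r := by
      rw [hrT]; exact Finset.mem_erase.2 ⟨hne, hk'⟩
    rw [map_sub, (mem_tightSet.1 this).2, (mem_tightSet.1 hk').2, sub_self]

lemma isSimplePolytope_polyhedron [Fintype ι] [Fintype J]
    (hbdd : Bornology.IsBounded (polyhedron g c f b S))
    (hsub : ∀ T T', Tub T → T' ⊆ T → Tub T')
    (htight : ∀ p ∈ polyhedron g c f b S, Tub (tightSet f b S p))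
    (hex : ∀ T, Tub T → ∃ p ∈ polyhedron g c f b S, tightSet f b S p = T)
    (hg : Function.Surjective (LinearMap.pi g)) :
    IsSimplePolytope (polyhedron g c f b S) := by
  refine ⟨isConvexPolytope_polyhedron hbdd, fun v hv => ?_⟩
  have hdim := fun T (hT : Tub T) => affDim_tightFace hsub hex hg hT
  obtain ⟨q, hqv, hq, hface⟩ := exists_eq_tightFace hv
  rw [mem_singleton_iff] at hqv
  subst hqv
  have hA := hdim ∅ (hsub _ _ (htight q hq) (Finset.empty_subset _))
  have hV := hdim _ (htight q hq)
  rw [← hface] at hV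
  have h0 : affDim ({q} : Set (ι → ℝ)) = 0 := by
    rw [affDim, direction_affineSpan, vectorSpan_singleton, finrank_bot]
  rw [tightFace_empty, Finset.card_empty] at hA
  have hone : ∀ k ∈ tightSet f b S q, Tub {k} := fun k hk =>
    hsub _ _ (htight q hq) (Finset.singleton_subset_iff.2 hk)
  have hmem : ∀ k ∈ tightSet f b S q, q ∈ tightFace g c f b S {k} := fun k hk =>
    ⟨hq, by simpa using (mem_tightSet.1 hk).2⟩
  -- By the dimension formula, facets are the tight faces of singletons.
  have hset : {F : Set (ι → ℝ) | IsFacet (polyhedron g c f b S) F ∧ q ∈ F} =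
      (fun k => tightFace g c f b S {k}) '' (tightSet f b S q : Set K) := by
    ext F
    constructor
    · rintro ⟨⟨hF, hFdim⟩, hqF⟩
      obtain ⟨r, -, hr, rfl⟩ := exists_eq_tightFace hF
      have hR := hdim _ (htight r hr)
      obtain ⟨k, hk⟩ := Finset.card_eq_one.1 (by omega : (tightSet f b S r).card = 1)
      refine ⟨k, ?_, by simp only [hk]⟩
      have hkr : k ∈ tightSet f b S r := by simp [hk]
      exact mem_tightSet.2 ⟨(mem_tightSet.1 hkr).1, hqF.2 k hkr⟩
    · rintro ⟨k, hk, rfl⟩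
      refine ⟨⟨isFace_tightFace ?_ ⟨q, hmem k hk⟩, ?_⟩, hmem k hk⟩
      · exact Finset.singleton_subset_iff.2 (mem_tightSet.1 hk).1
      · have := hdim _ (hone k hk)
        rw [Finset.card_singleton] at this
        beta_reduce
        omega
  rw [hset, Set.InjOn.ncard_image, Set.ncard_coe_finset]
  · omega
  · intro k hk k' hk' h
    obtain ⟨p, hp, hpk⟩ := hex _ (hone k hk)
    have h1 : p ∈ tightFace g c f b S {k'} := by
      rw [← show tightFace g c f b S {k} = tightFace g c f b S {k'} from h, ← hpk]
      exact mem_tightFace_tightSet hp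
    have h2 : k' ∈ tightSet f b S p :=
      mem_tightSet.2 ⟨(mem_tightSet.1 hk').1, h1.2 k' (Finset.mem_singleton_self _)⟩
    rw [hpk, Finset.mem_singleton] at h2
    exact h2.symm

end Polyhedron

/-! ### Connectivity in the Hasse diagram -/

section HasseConnectivity

variable {P : Type*} [PartialOrder P]

/-- The points `x` and `y` are joined by a path of the Hasse diagram inside `L`. -/
def JoinedWithin (L : Set P) (x y : P) : Prop :=
  ∃ s ⊆ L, x ∈ s ∧ y ∈ s ∧ ((SimpleGraph.hasse P).induce s).Connected

variable {L s : Set P} {x y z : P}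

lemma JoinedWithin.refl (hx : x ∈ L) : JoinedWithin L x x := by
  refine ⟨{x}, by simpa using hx, rfl, rfl, ?_⟩
  have : Subsingleton ({x} : Set P) := by infer_instance
  have : Nonempty ({x} : Set P) := ⟨⟨x, rfl⟩⟩
  exact ⟨SimpleGraph.Preconnected.of_subsingleton⟩

lemma JoinedWithin.symm (h : JoinedWithin L x y) : JoinedWithin L y x := by
  obtain ⟨s, hs, hx, hy, hc⟩ := h
  exact ⟨s, hs, hy, hx, hc⟩

lemma JoinedWithin.trans (h : JoinedWithin L x y) (h' : JoinedWithin L y z) :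
    JoinedWithin L x z := by
  obtain ⟨s, hs, hx, hy, hc⟩ := h
  obtain ⟨t, ht, hy', hz, hc'⟩ := h'
  exact ⟨s ∪ t, Set.union_subset hs ht, Or.inl hx, Or.inr hz,
    SimpleGraph.induce_union_connected hc.preconnected hc'.preconnected ⟨y, hy, hy'⟩⟩

lemma JoinedWithin.mono {M : Set P} (hLM : L ⊆ M) (h : JoinedWithin L x y) :
    JoinedWithin M x y := by
  obtain ⟨s, hs, hx, hy, hc⟩ := h
  exact ⟨s, hs.trans hLM, hx, hy, hc⟩

lemma hasse_adj_of_covBy (h : x ⋖ y) : (SimpleGraph.hasse P).Adj x y := by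
  rw [SimpleGraph.hasse_adj]
  exact Or.inl h

lemma JoinedWithin.of_le [Finite P] (h : x ≤ y) : JoinedWithin (Set.Icc x y) x y := by
  classical
  have := Fintype.ofFinite P
  let _ : LocallyFiniteOrder P := Fintype.toLocallyFiniteOrder
  have h' := le_iff_reflTransGen_covBy.1 h
  induction h' with
  | refl => exact JoinedWithin.refl ⟨le_rfl, le_rfl⟩
  | @tail b c hab hbc ih =>
    have hxb : x ≤ b := le_iff_reflTransGen_covBy.2 hab
    refine ((ih hxb).mono (Set.Icc_subset_Icc_right hbc.le)).trans ⟨{b, c}, ?_, by simp, by simp,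
      SimpleGraph.induce_pair_connected_of_adj (hasse_adj_of_covBy hbc)⟩
    rintro _ (rfl | rfl)
    · exact ⟨hxb, hbc.le⟩
    · exact ⟨h, le_rfl⟩

lemma connected_setOf_joinedWithin (hx : x ∈ L) :
    ((SimpleGraph.hasse P).induce {y | JoinedWithin L x y}).Connected := by
  refine SimpleGraph.induce_connected_of_patches x (JoinedWithin.refl hx) fun {y} hy => ?_
  obtain ⟨s, hs, hxs, hys, hc⟩ := hy
  exact ⟨s, fun z hz => ⟨s, hs, hxs, hz, hc⟩, hxs, hys, hc.preconnected _ _⟩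

lemma JoinedWithin.mem_right (h : JoinedWithin L x y) : y ∈ L := by
  obtain ⟨s, hs, -, hy, -⟩ := h
  exact hs hy

lemma ordConnected_setOf_joinedWithin [Finite P] (hL : L.OrdConnected) {a b c : P}
    (ha : JoinedWithin L x a) (hc : JoinedWithin L x c) (hab : a ≤ b) (hbc : b ≤ c) :
    JoinedWithin L x b :=
  ha.trans ((JoinedWithin.of_le hab).mono fun _ hz =>
    hL.out ha.mem_right hc.mem_right ⟨hz.1, hz.2.trans hbc⟩)

lemma iff_of_preconnected {Q : P → Prop} (hs : ((SimpleGraph.hasse P).induce s).Preconnected)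
    (hQ : ∀ i ∈ s, ∀ j ∈ s, i ⋖ j → (Q i ↔ Q j)) (hx : x ∈ s) (hy : y ∈ s) : Q x ↔ Q y := by
  obtain ⟨w⟩ := hs ⟨x, hx⟩ ⟨y, hy⟩
  have key : ∀ a b : s, ((SimpleGraph.hasse P).induce s).Walk a b → (Q a ↔ Q b) := by
    intro a b w
    induction w with
    | nil => rfl
    | @cons u v _ h _ ih =>
      refine Iff.trans ?_ ih
      rcases SimpleGraph.hasse_adj.1 (SimpleGraph.induce_adj.1 h) with h | h
      · exact hQ u u.2 v v.2 h
      · exact (hQ v v.2 u u.2 h).symm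
  exact key _ _ w

end HasseConnectivity

/-! ### Sums of rises over covering relations -/

section Edges

/-- The half-open intervals from `p e.1` to `p e.2` cover `[a, b)`, so their total length is at
least `b - a`. -/
lemma sub_le_sum_of_forall_exists {P : Type*} {p : P → ℝ} {E : Finset (P × P)} {a b : ℝ}
    (hE : ∀ e ∈ E, p e.1 ≤ p e.2) (hcov : ∀ c, a ≤ c → c < b → ∃ e ∈ E, p e.1 ≤ c ∧ c < p e.2) :
    b - a ≤ ∑ e ∈ E, (p e.2 - p e.1) := by
  have hsub : Set.Ico a b ⊆ ⋃ e ∈ E, Set.Ico (p e.1) (p e.2) := by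
    intro c hc
    obtain ⟨e, he, h⟩ := hcov c hc.1 hc.2
    exact Set.mem_biUnion he h
  have h := (MeasureTheory.measure_mono (μ := MeasureTheory.volume) hsub).trans
    (MeasureTheory.measure_biUnion_finset_le E _)
  simp only [Real.volume_Ico] at h
  rw [← ENNReal.ofReal_sum_of_nonneg fun e he => sub_nonneg.2 (hE e he)] at h
  exact (ENNReal.ofReal_le_ofReal_iff
    (Finset.sum_nonneg fun e he => sub_nonneg.2 (hE e he))).1 h

variable {P : Type*} [PartialOrder P]

open Classical in
/-- The covering relations of `P` between elements of `τ`. -/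
noncomputable def edges (τ : Finset P) : Finset (P × P) :=
  {e ∈ τ ×ˢ τ | e.1 ⋖ e.2}

variable {σ τ : Finset P} {p q : P → ℝ} {i j x y : P} {e : P × P}

lemma mem_edges : e ∈ edges τ ↔ e.1 ∈ τ ∧ e.2 ∈ τ ∧ e.1 ⋖ e.2 := by
  simp [edges, and_assoc]

lemma edges_mono (h : σ ⊆ τ) : edges σ ⊆ edges τ := fun e he => by
  rw [mem_edges] at he ⊢
  exact ⟨h he.1, h he.2.1, he.2.2⟩

lemma alpha_eq_sum_edges (τ : Finset P) (p : P → ℝ) :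
    alpha τ p = ∑ e ∈ edges τ, (p e.2 - p e.1) := by
  classical
  rw [alpha, edges, Finset.sum_filter, Finset.sum_product]
  simp only [Finset.sum_filter]

/-- `alpha τ` as a linear functional. -/
noncomputable def alphaLin (τ : Finset P) : (P → ℝ) →ₗ[ℝ] ℝ :=
  ∑ e ∈ edges τ, ((LinearMap.proj e.2 : (P → ℝ) →ₗ[ℝ] ℝ) - LinearMap.proj e.1)

lemma alphaLin_apply (τ : Finset P) (p : P → ℝ) : alphaLin τ p = alpha τ p := by
  simp [alphaLin, alpha_eq_sum_edges]

lemma two_mul_card_edges_le (τ : Finset P) :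
    2 * ((edges τ).card : ℝ) ≤ τ.card * (τ.card - 1) := by
  classical
  -- Each edge and its reversal are two distinct ordered pairs of distinct points.
  have hdisj : Disjoint (edges τ) ((edges τ).image Prod.swap) := by
    rw [Finset.disjoint_left]
    intro e he he'
    obtain ⟨e', h, rfl⟩ := Finset.mem_image.1 he'
    exact lt_asymm (mem_edges.1 he).2.2.lt (mem_edges.1 h).2.2.lt
  have hsub : edges τ ∪ (edges τ).image Prod.swap ⊆ τ.offDiag := by
    intro e he
    rw [Finset.mem_offDiag]
    rcases Finset.mem_union.1 he with he | he
    · exact ⟨(mem_edges.1 he).1, (mem_edges.1 he).2.1, (mem_edges.1 he).2.2.ne⟩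
    · obtain ⟨e', he', rfl⟩ := Finset.mem_image.1 he
      exact ⟨(mem_edges.1 he').2.1, (mem_edges.1 he').1, (mem_edges.1 he').2.2.ne'⟩
  have h := Finset.card_le_card hsub
  rw [Finset.card_union_of_disjoint hdisj, Finset.card_image_of_injective _ Prod.swap_injective,
    Finset.offDiag_card] at h
  have h2 : 2 * (edges τ).card + τ.card ≤ τ.card * τ.card := by
    have := Nat.le_mul_self τ.card
    omega
  have h3 : (2 * (edges τ).card + τ.card : ℝ) ≤ τ.card * τ.card := by exact_mod_cast h2
  linarith

lemma two_mul_card_edges_le_card [Fintype P] (τ : Finset P) :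
    2 * ((edges τ).card : ℝ) ≤ Fintype.card P * (Fintype.card P - 1) := by
  refine (two_mul_card_edges_le τ).trans ?_
  have h : (τ.card : ℝ) ≤ Fintype.card P := by exact_mod_cast Finset.card_le_univ τ
  rcases Nat.eq_zero_or_pos τ.card with h0 | h0
  · rcases Nat.eq_zero_or_pos (Fintype.card P) with h1 | h1
    · simp [h0, h1]
    · have : (1 : ℝ) ≤ Fintype.card P := by exact_mod_cast h1
      rw [h0]
      push_cast
      nlinarith
  · have : (1 : ℝ) ≤ τ.card := by exact_mod_cast h0
    nlinarith

lemma exists_edge_crossing (hτ : ((SimpleGraph.hasse P).induce (τ : Set P)).Connected)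
    (hp : ∀ e ∈ edges τ, p e.1 ≤ p e.2) (hx : x ∈ τ) (hy : y ∈ τ) {c : ℝ} (hxc : p x ≤ c)
    (hcy : c < p y) : ∃ e ∈ edges τ, p e.1 ≤ c ∧ c < p e.2 := by
  by_contra! hcon
  have := iff_of_preconnected (Q := fun z => p z ≤ c) hτ.preconnected (fun i hi j hj hij => by
    have he : (i, j) ∈ edges τ := mem_edges.2 ⟨hi, hj, hij⟩
    exact ⟨fun h => hcon _ he h, fun h => (hp _ he).trans h⟩) hx hy
  exact absurd (this.1 hxc) hcy.not_ge

lemma sub_le_alpha (hτ : ((SimpleGraph.hasse P).induce (τ : Set P)).Connected)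
    (hp : ∀ e ∈ edges τ, p e.1 ≤ p e.2) (hx : x ∈ τ) (hy : y ∈ τ) :
    p y - p x ≤ alpha τ p := by
  rw [alpha_eq_sum_edges]
  exact sub_le_sum_of_forall_exists hp fun c h1 h2 => exists_edge_crossing hτ hp hx hy h1 h2

lemma sub_le_alpha_of_mem_edges (hp : ∀ e ∈ edges τ, p e.1 ≤ p e.2) (he : e ∈ edges τ) :
    p e.2 - p e.1 ≤ alpha τ p := by
  rw [alpha_eq_sum_edges]
  exact Finset.single_le_sum (f := fun e : P × P => p e.2 - p e.1)
    (fun e he => sub_nonneg.2 (hp e he)) he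

lemma alpha_congr {k : ℝ} (h : ∀ x ∈ τ, q x = p x + k) : alpha τ q = alpha τ p := by
  rw [alpha_eq_sum_edges, alpha_eq_sum_edges]
  refine Finset.sum_congr rfl fun e he => ?_
  rw [h _ (mem_edges.1 he).1, h _ (mem_edges.1 he).2.1]
  ring

lemma alpha_le_of_forall_le {D : ℝ} (h : ∀ e ∈ edges τ, p e.2 - p e.1 ≤ D) :
    alpha τ p ≤ (edges τ).card * D := by
  rw [alpha_eq_sum_edges]
  simpa using Finset.sum_le_card_nsmul _ _ D h

end Edges

/-! ### Two-element tubes and the whole poset -/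

section Tubes

variable {P : Type*} [PartialOrder P] {σ τ : Finset P} {i j : P}

open Classical in
lemma isTube_pair (h : i ⋖ j) : IsTube ({i, j} : Finset P) := by
  refine ⟨?_, ?_, (Finset.card_pair h.ne).ge⟩
  · have := SimpleGraph.induce_pair_connected_of_adj (hasse_adj_of_covBy h)
    rwa [Finset.coe_pair]
  · intro a ha c hc b hab hbc
    have hib : i ≤ b := by
      refine le_trans ?_ hab
      rcases Finset.mem_insert.1 ha with rfl | ha
      · exact le_rfl
      · rw [Finset.mem_singleton.1 ha]; exact h.le
    have hbj : b ≤ j := by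
      refine hbc.trans ?_
      rcases Finset.mem_insert.1 hc with rfl | hc
      · exact h.le
      · rw [Finset.mem_singleton.1 hc]
    rcases h.eq_or_eq hib hbj with rfl | rfl <;> simp

open Classical in
lemma alpha_pair (h : i ⋖ j) (p : P → ℝ) : alpha ({i, j} : Finset P) p = p j - p i := by
  have : edges ({i, j} : Finset P) = {(i, j)} := by
    ext ⟨a, b⟩
    simp only [mem_edges, Finset.mem_insert, Finset.mem_singleton, Prod.mk.injEq]
    constructor
    · rintro ⟨rfl | rfl, rfl | rfl, hab⟩
      · exact absurd rfl hab.ne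
      · exact ⟨rfl, rfl⟩
      · exact absurd hab.lt h.lt.asymm
      · exact absurd rfl hab.ne
    · rintro ⟨rfl, rfl⟩
      exact ⟨Or.inl rfl, Or.inr rfl, h⟩
  rw [alpha_eq_sum_edges, this, Finset.sum_singleton]

lemma IsTube.nonempty (h : IsTube τ) : τ.Nonempty :=
  Finset.card_pos.1 (by have := h.2.2; omega)

lemma isTube_univ [Fintype P] (hconn : (SimpleGraph.hasse P).Connected)
    (hcard : 2 ≤ Fintype.card P) : IsTube (Finset.univ : Finset P) := by
  refine ⟨?_, fun _ _ _ _ _ _ _ => Finset.mem_univ _, hcard⟩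
  rw [Finset.coe_univ]
  exact (SimpleGraph.induceUnivIso _).connected_iff.2 hconn

end Tubes

/-! ### Tight tubes form a tubing -/

section TightTubes

variable {P : Type*} [PartialOrder P] [Fintype P] {p : P → ℝ}

lemma strictMono_of_forall_tube
    (hp : ∀ σ : Finset P, IsTube σ → (Fintype.card P : ℝ) ^ (2 * σ.card) ≤ alpha σ p) :
    StrictMono p := by
  classical
  let _ : LocallyFiniteOrder P := Fintype.toLocallyFiniteOrder
  rw [strictMono_iff_forall_covBy]
  intro i j hij
  have : Nonempty P := ⟨i⟩
  have h := hp _ (isTube_pair hij)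
  rw [alpha_pair hij] at h
  have : (0 : ℝ) < Fintype.card P := by exact_mod_cast Fintype.card_pos
  have := pow_pos this (2 * ({i, j} : Finset P).card)
  linarith

lemma two_mul_pow_le_of_joinedWithin
    (hp : ∀ σ : Finset P, IsTube σ → (Fintype.card P : ℝ) ^ (2 * σ.card) ≤ alpha σ p)
    {lo hi : ℝ} {x : P} {U : Finset P} (hU : 2 ≤ U.card) (hx : x ∈ U)
    (hjoin : ∀ y ∈ U, JoinedWithin {z | lo ≤ p z ∧ p z ≤ hi} x y) :
    2 * (Fintype.card P : ℝ) ^ (2 * U.card) ≤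
      Fintype.card P * (Fintype.card P - 1) * (hi - lo) := by
  classical
  have hmono := strictMono_of_forall_tube hp
  have hL : Set.OrdConnected {z | lo ≤ p z ∧ p z ≤ hi} := ⟨fun a ha b hb c hc =>
    ⟨ha.1.trans (hmono.monotone hc.1), (hmono.monotone hc.2).trans hb.2⟩⟩
  -- The component of `x` in the band: convex because `p` is increasing, hence a tube.
  let ρ : Finset P := {y | JoinedWithin {z | lo ≤ p z ∧ p z ≤ hi} x y}
  have hmem : ∀ y, y ∈ ρ ↔ JoinedWithin {z | lo ≤ p z ∧ p z ≤ hi} x y := by simp [ρ]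
  have hUρ : U ⊆ ρ := fun y hy => (hmem y).2 (hjoin y hy)
  have hcard := Finset.card_le_card hUρ
  have hxL := (hjoin x hx).mem_right
  have hρ : IsTube ρ := by
    refine ⟨?_, fun a ha c hc b hab hbc => ?_, hU.trans hcard⟩
    · have := connected_setOf_joinedWithin hxL
      rwa [show {y | JoinedWithin {z | lo ≤ p z ∧ p z ≤ hi} x y} = (ρ : Set P) by
        ext y; simp [ρ]] at this
    · rw [hmem] at ha hc ⊢
      exact ordConnected_setOf_joinedWithin hL ha hc hab hbc
  have h1 : (1 : ℝ) ≤ Fintype.card P := by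
    have : Nonempty P := ⟨x⟩
    exact_mod_cast Fintype.card_pos (α := P)
  have h2 : (Fintype.card P : ℝ) ^ (2 * U.card) ≤ (Fintype.card P : ℝ) ^ (2 * ρ.card) :=
    pow_le_pow_right₀ h1 (by omega)
  have h3 : alpha ρ p ≤ (edges ρ).card * (hi - lo) := by
    refine alpha_le_of_forall_le fun e he => ?_
    have ha := ((hmem _).1 (mem_edges.1 he).1).mem_right.1
    have hb := ((hmem _).1 (mem_edges.1 he).2.1).mem_right.2
    linarith
  have h4 := two_mul_card_edges_le_card ρ
  have h5 : 0 ≤ hi - lo := sub_nonneg.2 (hxL.1.trans hxL.2)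
  nlinarith [hp ρ hρ, mul_le_mul_of_nonneg_right h4 h5]

lemma le_pow_of_alpha_eq {σ : Finset P} {m : ℕ} (hmono : StrictMono p) (hσ : IsTube σ)
    (h : alpha σ p = (Fintype.card P : ℝ) ^ (2 * σ.card)) (hm : σ.card ≤ m) {x y : P}
    (hx : x ∈ σ) (hy : y ∈ σ) : p y - p x ≤ (Fintype.card P : ℝ) ^ (2 * m) := by
  have h1 : (1 : ℝ) ≤ Fintype.card P := by
    have : Nonempty P := ⟨x⟩
    exact_mod_cast Fintype.card_pos (α := P)
  refine (sub_le_alpha hσ.1 (fun e he => (hmono (mem_edges.1 he).2.2.lt).le) hx hy).trans ?_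
  rw [h]
  exact pow_le_pow_right₀ h1 (by omega)

lemma nested_or_disjoint_of_alpha_eq (hn : 2 ≤ Fintype.card P)
    (hp : ∀ σ : Finset P, IsTube σ → (Fintype.card P : ℝ) ^ (2 * σ.card) ≤ alpha σ p)
    {σ τ : Finset P} (hσ : IsTube σ) (hτ : IsTube τ)
    (hσp : alpha σ p = (Fintype.card P : ℝ) ^ (2 * σ.card))
    (hτp : alpha τ p = (Fintype.card P : ℝ) ^ (2 * τ.card)) :
    σ ⊆ τ ∨ τ ⊆ σ ∨ Disjoint σ τ := by
  classical
  have hmono := strictMono_of_forall_tube hp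
  by_contra! hcon
  obtain ⟨h1, h2, h3⟩ := hcon
  obtain ⟨z, hzσ, hzτ⟩ := Finset.not_disjoint_iff.1 h3
  set m := max σ.card τ.card with hm
  set D := (Fintype.card P : ℝ) ^ (2 * m) with hD
  have hcard : m + 1 ≤ (σ ∪ τ).card := by
    have ha : σ.card < (σ ∪ τ).card := Finset.card_lt_card
      ⟨Finset.subset_union_left, fun h => h2 (Finset.subset_union_right.trans h)⟩
    have hb : τ.card < (σ ∪ τ).card := Finset.card_lt_card
      ⟨Finset.subset_union_right, fun h => h1 (Finset.subset_union_left.trans h)⟩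
    omega
  have hL : ∀ y ∈ σ ∪ τ, p z - D ≤ p y ∧ p y ≤ p z + D := by
    intro y hy
    rcases Finset.mem_union.1 hy with hy | hy
    · have ha := le_pow_of_alpha_eq hmono hσ hσp (le_max_left _ _ : _ ≤ m) hzσ hy
      have hb := le_pow_of_alpha_eq hmono hσ hσp (le_max_left _ _ : _ ≤ m) hy hzσ
      constructor <;> linarith
    · have ha := le_pow_of_alpha_eq hmono hτ hτp (le_max_right _ _ : _ ≤ m) hzτ hy
      have hb := le_pow_of_alpha_eq hmono hτ hτp (le_max_right _ _ : _ ≤ m) hy hzτ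
      constructor <;> linarith
  -- Both tubes lie within `D` of the value at the common point `z`, so the band has width `2 * D`;
  -- but the union has at least `m + 1` elements and needs more.
  have hkey := two_mul_pow_le_of_joinedWithin hp (lo := p z - D) (hi := p z + D) (x := z)
    (U := σ ∪ τ) (by have := hσ.2.2; omega) (Finset.mem_union_left _ hzσ) (fun y hy => by
      rcases Finset.mem_union.1 hy with hy | hy
      · exact ⟨σ, fun w hw => hL w (Finset.mem_union_left _ hw), hzσ, hy, hσ.1⟩
      · exact ⟨τ, fun w hw => hL w (Finset.mem_union_right _ hw), hzτ, hy, hτ.1⟩)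
  have hn' : (2 : ℝ) ≤ Fintype.card P := by exact_mod_cast hn
  have hpow : (Fintype.card P : ℝ) ^ 2 * D ≤ (Fintype.card P : ℝ) ^ (2 * (σ ∪ τ).card) := by
    rw [hD, ← pow_add]
    exact pow_le_pow_right₀ (by linarith) (by omega)
  have hDpos : 0 < D := by positivity
  have hnD : 0 < (Fintype.card P : ℝ) * D := by positivity
  nlinarith

lemma acyclic_of_alpha_eq (hn : 2 ≤ Fintype.card P)
    (hp : ∀ σ : Finset P, IsTube σ → (Fintype.card P : ℝ) ^ (2 * σ.card) ≤ alpha σ p)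
    {T : Finset (Finset P)} (hT : ∀ σ ∈ T, IsTube σ)
    (hTp : ∀ σ ∈ T, alpha σ p = (Fintype.card P : ℝ) ^ (2 * σ.card)) (τ : Finset P) :
    ¬ Relation.TransGen (fun σ ρ : Finset P => σ ∈ T ∧ ρ ∈ T ∧ TubeLT σ ρ) τ τ := by
  classical
  intro hcyc
  set R := fun σ ρ : Finset P => σ ∈ T ∧ ρ ∈ T ∧ TubeLT σ ρ with hR
  have hmono := strictMono_of_forall_tube hp
  -- The strongly connected class of `τ` under `≺`, used in place of one chosen cycle.
  set C : Finset (Finset P) :=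
    {σ ∈ T | Relation.TransGen R τ σ ∧ Relation.TransGen R σ τ} with hC
  have hmemC : ∀ σ, Relation.TransGen R τ σ → Relation.TransGen R σ τ → σ ∈ C := by
    intro σ h1 h2
    rw [hC, Finset.mem_filter]
    refine ⟨?_, h1, h2⟩
    cases h1 with
    | single h => exact h.2.1
    | tail _ h => exact h.2.1
  have hCT : ∀ σ ∈ C, σ ∈ T ∧ Relation.TransGen R τ σ ∧ Relation.TransGen R σ τ := fun σ hσ => by
    simpa [hC] using hσ
  have hτC := hmemC τ hcyc hcyc
  set U : Finset P := C.biUnion id with hU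
  have hmemU : ∀ σ ∈ C, ∀ y ∈ σ, y ∈ U := fun σ hσ y hy => Finset.mem_biUnion.2 ⟨σ, hσ, hy⟩
  obtain ⟨x, hx⟩ := (hT τ (hCT τ hτC).1).nonempty
  have hxU := hmemU τ hτC x hx
  obtain ⟨xlo, hxlo, hlo⟩ := Finset.exists_min_image U p ⟨x, hxU⟩
  obtain ⟨xhi, hxhi, hhi⟩ := Finset.exists_max_image U p ⟨x, hxU⟩
  obtain ⟨μ, hμ, hmax⟩ := Finset.exists_max_image C Finset.card ⟨τ, hτC⟩
  set D := (Fintype.card P : ℝ) ^ (2 * μ.card) with hD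
  have hstep : ∀ σ ∈ C, ∀ ρ ∈ C, R σ ρ → ∀ a ∈ σ, ∀ b ∈ ρ,
      JoinedWithin {z | p xlo ≤ p z ∧ p z ≤ p xhi} a b := by
    rintro σ hσ ρ hρ ⟨-, -, -, u, hu, v, hv, huv⟩ a ha b hb
    have hsub : ∀ ν ∈ C, (ν : Set P) ⊆ {z | p xlo ≤ p z ∧ p z ≤ p xhi} := fun ν hν w hw =>
      ⟨hlo w (hmemU ν hν w hw), hhi w (hmemU ν hν w hw)⟩
    have h1 : JoinedWithin {z | p xlo ≤ p z ∧ p z ≤ p xhi} a u :=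
      ⟨σ, hsub σ hσ, ha, hu, (hT σ (hCT σ hσ).1).1⟩
    have h3 : JoinedWithin {z | p xlo ≤ p z ∧ p z ≤ p xhi} v b :=
      ⟨ρ, hsub ρ hρ, hv, hb, (hT ρ (hCT ρ hρ).1).1⟩
    refine (h1.trans ((JoinedWithin.of_le huv.le).mono fun w hw => ?_)).trans h3
    exact ⟨(hsub σ hσ hu).1.trans (hmono.monotone hw.1),
      (hmono.monotone hw.2).trans (hsub ρ hρ hv).2⟩
  have hjoin : ∀ σ, Relation.TransGen R τ σ → Relation.TransGen R σ τ → ∀ y ∈ σ,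
      JoinedWithin {z | p xlo ≤ p z ∧ p z ≤ p xhi} x y := by
    intro σ h
    induction h with
    | single h =>
      intro h' y hy
      exact hstep τ hτC _ (hmemC _ (.single h) h') h x hx y hy
    | @tail ρ σ h1 h2 ih =>
      intro h' y hy
      have hρ : Relation.TransGen R ρ τ := Relation.TransGen.head h2 h'
      obtain ⟨w, hw⟩ := (hT ρ h2.1).nonempty
      exact (ih hρ w hw).trans (hstep ρ (hmemC _ h1 hρ) σ (hmemC _ (h1.tail h2) h') h2 w hw y hy)
  -- If no edge crosses the value `c`, each tube of `C` lies on one side of `c`. Since `≺` cannot go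
  -- down across `c`, strong connectivity puts all tubes above it, although `xlo` is not.
  have hcross : ∀ c, p xlo ≤ c → c < p xhi → ∃ e ∈ C.biUnion edges, p e.1 ≤ c ∧ c < p e.2 := by
    intro c hc1 hc2
    by_contra! hcon
    have hside : ∀ σ ∈ C, (∃ y ∈ σ, c < p y) → ∀ y ∈ σ, c < p y := by
      rintro σ hσ ⟨y, hy, hcy⟩ w hw
      by_contra! hwc
      obtain ⟨e, he, h1, h2⟩ := exists_edge_crossing (hT σ (hCT σ hσ).1).1
        (fun e he => (hmono (mem_edges.1 he).2.2.lt).le) hw hy hwc hcy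
      exact absurd h2 (hcon e (Finset.mem_biUnion.2 ⟨σ, hσ, he⟩) h1).not_gt
    obtain ⟨σ₁, hσ₁, hx₁⟩ := Finset.mem_biUnion.1 hxhi
    obtain ⟨σ₂, hσ₂, hx₂⟩ := Finset.mem_biUnion.1 hxlo
    have hprop : ∀ ρ, Relation.TransGen R σ₁ ρ → Relation.TransGen R ρ τ → ∃ y ∈ ρ, c < p y := by
      intro ρ h
      induction h with
      | single h =>
        obtain ⟨-, -, -, a, ha, b, hb, hab⟩ := h
        exact fun _ => ⟨b, hb, (hside σ₁ hσ₁ ⟨xhi, hx₁, hc2⟩ a ha).trans (hmono hab)⟩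
      | @tail ν ρ h1 h2 ih =>
        intro h'
        have hν : Relation.TransGen R ν τ := Relation.TransGen.head h2 h'
        have hνC := hmemC ν ((hCT σ₁ hσ₁).2.1.trans h1) hν
        obtain ⟨-, -, -, a, ha, b, hb, hab⟩ := h2
        exact ⟨b, hb, (hside ν hνC (ih hν) a ha).trans (hmono hab)⟩
    exact absurd (hside σ₂ hσ₂ (hprop σ₂ ((hCT σ₁ hσ₁).2.2.trans (hCT σ₂ hσ₂).2.1)
      (hCT σ₂ hσ₂).2.2) xlo hx₂) hc1.not_gt
  have hspread : p xhi - p xlo ≤ (edges (Finset.univ : Finset P)).card * D := by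
    have hE : ∀ e ∈ C.biUnion edges, p e.1 ≤ p e.2 := fun e he => by
      obtain ⟨σ, -, he⟩ := Finset.mem_biUnion.1 he
      exact (hmono (mem_edges.1 he).2.2.lt).le
    refine (sub_le_sum_of_forall_exists hE hcross).trans ?_
    refine (Finset.sum_le_card_nsmul _ _ D fun e he => ?_).trans ?_
    · obtain ⟨σ, hσ, he⟩ := Finset.mem_biUnion.1 he
      exact le_pow_of_alpha_eq hmono (hT σ (hCT σ hσ).1) (hTp σ (hCT σ hσ).1) (hmax σ hσ)
        (mem_edges.1 he).1 (mem_edges.1 he).2.1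
    · rw [nsmul_eq_mul]
      refine mul_le_mul_of_nonneg_right ?_ (by positivity)
      exact_mod_cast Finset.card_le_card (Finset.biUnion_subset.2 fun σ _ =>
        edges_mono (Finset.subset_univ σ))
  -- The successor of the largest tube `μ` in `C` is disjoint from it and has at least two elements.
  have hcardU : μ.card + 2 ≤ U.card := by
    obtain ⟨ρ, hμρ, hρτ⟩ := Relation.TransGen.head'_iff.1 (hCT μ hμ).2.2
    have hρC : ρ ∈ C := hmemC ρ ((hCT μ hμ).2.1.tail hμρ) (Relation.TransGen.trans_right hρτ hcyc)
    have hle := Finset.card_le_card (Finset.union_subset (fun y hy => hmemU μ hμ y hy)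
      (fun y hy => hmemU ρ hρC y hy))
    rw [Finset.card_union_of_disjoint hμρ.2.2.1] at hle
    have := (hT ρ hμρ.2.1).2.2
    omega
  have hkey := two_mul_pow_le_of_joinedWithin hp (x := x) (U := U) (by omega) hxU (fun y hy => by
    obtain ⟨σ, hσ, hy⟩ := Finset.mem_biUnion.1 hy
    exact hjoin σ (hCT σ hσ).2.1 (hCT σ hσ).2.2 y hy)
  have hn' : (2 : ℝ) ≤ Fintype.card P := by exact_mod_cast hn
  have hpow : (Fintype.card P : ℝ) ^ 4 * D ≤ (Fintype.card P : ℝ) ^ (2 * U.card) := by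
    rw [hD, ← pow_add]
    exact pow_le_pow_right₀ (by linarith) (by omega)
  have hDpos : 0 < D := by positivity
  have hedges := two_mul_card_edges_le_card (Finset.univ : Finset P)
  set n : ℝ := (Fintype.card P : ℝ) with hndef
  have h1 : 2 * (p xhi - p xlo) ≤ n * (n - 1) * D := by nlinarith
  have h2 : 0 ≤ n * (n - 1) := by nlinarith
  have h3 : 4 * (n ^ 4 * D) ≤ n * (n - 1) * (n * (n - 1) * D) := by nlinarith
  have h4 : n * (n - 1) ≤ n ^ 2 := by nlinarith
  have h5 : n * (n - 1) * (n * (n - 1)) ≤ n ^ 2 * n ^ 2 := mul_le_mul h4 h4 h2 (by positivity)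
  have h6 : 0 < n ^ 4 * D := by positivity
  nlinarith

end TightTubes

/-! ### Stretching a function along levels -/

section Scaling

variable {P : Type*} [PartialOrder P] {σ τ : Finset P} {p : P → ℝ}

open Classical in
lemma card_edges_at_le (τ : Finset P) (x : P) :
    {e ∈ edges τ | e.1 = x ∨ e.2 = x}.card ≤ (τ.erase x).card := by
  -- Send an edge at `x` to its other end; this is injective because an end cannot be both above and
  -- below `x`.
  refine Finset.card_le_card_of_injOn (fun e => if e.1 = x then e.2 else e.1) ?_ ?_
  · intro e he
    obtain ⟨he, hx⟩ := Finset.mem_filter.1 (Finset.mem_coe.1 he)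
    rw [mem_edges] at he
    by_cases h : e.1 = x
    · simpa [h, he.2.1] using fun h' => he.2.2.ne (h.trans h'.symm)
    · simp [h, he.1]
  · rintro ⟨a, b⟩ he ⟨a', b'⟩ he' h
    obtain ⟨h_e, hx⟩ := Finset.mem_filter.1 (Finset.mem_coe.1 he)
    obtain ⟨h_e', hx'⟩ := Finset.mem_filter.1 (Finset.mem_coe.1 he')
    rw [mem_edges] at h_e h_e'
    clear he he'
    simp only at h_e h_e' hx hx' h ⊢
    by_cases h1 : a = x <;> by_cases h2 : a' = x
    · simp_all
    · have h3 := hx'.resolve_left h2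
      subst h1 h3
      simp only [if_true, if_neg h2] at h
      subst h
      exact absurd h_e.2.2.lt h_e'.2.2.lt.asymm
    · have h3 := hx.resolve_left h1
      subst h2 h3
      simp only [if_true, if_neg h1] at h
      subst h
      exact absurd h_e.2.2.lt h_e'.2.2.lt.asymm
    · simp_all

/-- Only edges at the one extra point are added, and there are at most `n - 1` of them. -/
lemma alpha_sub_le_of_card [Fintype P] {B : ℝ} (hB : 0 ≤ B) (hστ : σ ⊆ τ)
    (hcard : σ.card + 1 = τ.card) (h : ∀ e ∈ edges τ, p e.2 - p e.1 ≤ B) :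
    alpha τ p - alpha σ p ≤ (Fintype.card P - 1) * B := by
  classical
  obtain ⟨x, hx, rfl⟩ : ∃ x, x ∉ σ ∧ insert x σ = τ :=
    Finset.covBy_iff_exists_insert.1 (Finset.covBy_iff_card_sdiff_eq_one.2 ⟨hστ, by
      rw [Finset.card_sdiff_of_subset hστ]; omega⟩)
  have hfilter : edges (insert x σ) \ edges σ ⊆
      {e ∈ edges (insert x σ) | e.1 = x ∨ e.2 = x} := by
    intro e he
    obtain ⟨h1, h2⟩ := Finset.mem_sdiff.1 he
    refine Finset.mem_filter.2 ⟨h1, ?_⟩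
    rw [mem_edges] at h1 h2
    by_contra! hne
    exact h2 ⟨(Finset.mem_insert.1 h1.1).resolve_left hne.1,
      (Finset.mem_insert.1 h1.2.1).resolve_left hne.2, h1.2.2⟩
  have hle : (edges (insert x σ) \ edges σ).card + 1 ≤ Fintype.card P := by
    have h1 := (Finset.card_le_card hfilter).trans (card_edges_at_le _ x)
    rw [Finset.erase_insert hx] at h1
    have h2 := Finset.card_le_univ (insert x σ)
    omega
  have hle' : ((edges (insert x σ) \ edges σ).card : ℝ) ≤ Fintype.card P - 1 := by
    have : ((edges (insert x σ) \ edges σ).card + 1 : ℝ) ≤ Fintype.card P := by exact_mod_cast hle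
    linarith
  rw [alpha_eq_sum_edges, alpha_eq_sum_edges, ← Finset.sum_sdiff (edges_mono hστ),
    add_sub_cancel_right]
  refine (Finset.sum_le_card_nsmul _ _ B fun e he => h e (Finset.mem_sdiff.1 he).1).trans ?_
  rw [nsmul_eq_mul]
  exact mul_le_mul_of_nonneg_right hle' hB

/-- Arithmetic for `exists_stretch`, with `M = n^(2(|τ|-2))` and `K = n^(2(|τ|-L))`: a stretch
factor of at most `M + K` would leave `alpha τ` below `n^(2|τ|)`. -/
lemma mul_add_lt_of_pow {n K M : ℝ} {L : ℕ} (hn : 2 ≤ n) (hM : 0 < M) (hL : 1 ≤ L)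
    (hLn : (L : ℝ) + 1 ≤ n) (hK1 : L = 1 → K = n ^ 2 * M) (hK2 : 2 ≤ L → K ≤ M) :
    n * (n - 1) * (L * (M + K) + K) < 2 * (n ^ 4 * M) := by
  have hnn : 0 < n * (n - 1) := by nlinarith
  rcases hL.eq_or_lt with h | h
  · subst h
    rw [hK1 rfl]
    have : n * (n - 1) * (1 + 2 * n ^ 2) < 2 * n ^ 4 := by nlinarith [sq_nonneg n]
    have h' := mul_lt_mul_of_pos_right this hM
    push_cast
    linarith
  · have hKM := hK2 h
    have h1 : (L : ℝ) * (M + K) + K ≤ (2 * n - 1) * M := by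
      have hL0 : (0 : ℝ) ≤ L := Nat.cast_nonneg L
      nlinarith [mul_le_mul_of_nonneg_left hKM hL0, mul_le_mul_of_nonneg_right hLn hM.le]
    have h2 := mul_le_mul_of_nonneg_left h1 hnn.le
    have h3 : n * (n - 1) * (2 * n - 1) < 2 * n ^ 4 := by
      have : n * (n - 1) * (2 * n - 1) ≤ n * n * (2 * n) := by
        apply mul_le_mul <;> nlinarith
      have h4 : 0 < n ^ 3 := by positivity
      nlinarith
    have h5 := mul_lt_mul_of_pos_right h3 hM
    linarith

/-- The same kind of estimate for a tube with one point fewer than `τ`, now with `M = n^(2(|τ|-1))`.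
-/
lemma mul_add_lt_of_pow_of_three_le {n K M : ℝ} {L : ℕ} (hn : 3 ≤ n) (hM : 0 < M) (hL : 1 ≤ L)
    (hLn : (L : ℝ) + 1 ≤ n) (hK1 : L = 1 → K = M) (hK2 : 2 ≤ L → n ^ 2 * K ≤ M) :
    (n - 1) * (L * (M + K) + K) < n ^ 2 * M - M := by
  have key : L * (M + K) + K < (n + 1) * M := by
    rcases hL.eq_or_lt with h | h
    · subst h
      rw [hK1 rfl]
      push_cast
      nlinarith
    · have hKM := hK2 h
      have h1 : (L + 1 : ℝ) * (n ^ 2 * K) ≤ (L + 1) * M :=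
        mul_le_mul_of_nonneg_left hKM (by positivity)
      have h2 : ((L : ℝ) + 1) * M ≤ n * M := mul_le_mul_of_nonneg_right hLn hM.le
      have h3 : n ^ 2 * (L * M) ≤ n ^ 2 * ((n - 1) * M) := by gcongr; linarith
      have h4 : n * M < n ^ 2 * M := by
        have : n < n ^ 2 := by nlinarith
        exact mul_lt_mul_of_pos_right this hM
      have h5 : n ^ 2 * (L * (M + K) + K) < n ^ 2 * ((n + 1) * M) := by nlinarith
      exact lt_of_mul_lt_mul_left h5 (by positivity)
  nlinarith

/-- Levels on a tube can be stretched to a function with the prescribed value of `alpha`, and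
then each smaller tube with an edge between different levels has a large value of `alpha`. -/
lemma exists_stretch [Fintype P] {ℓ : P → ℕ} {r : P → ℝ} {L : ℕ} (hL : L + 1 ≤ τ.card)
    (hℓ : ∀ x ∈ τ, ℓ x ≤ L)
    (hr : ∀ x ∈ τ, 0 ≤ r x ∧ r x ≤ (Fintype.card P : ℝ) ^ (2 * (τ.card - L)))
    (hedge : ∀ e ∈ edges τ, ℓ e.1 = ℓ e.2 ∧ r e.1 < r e.2 ∨ ℓ e.1 < ℓ e.2)
    (hcross : ∃ e ∈ edges τ, ℓ e.1 < ℓ e.2) :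
    ∃ h : ℝ, alpha τ (fun x => h * ℓ x + r x) = (Fintype.card P : ℝ) ^ (2 * τ.card) ∧
      (∀ e ∈ edges τ, h * ℓ e.1 + r e.1 < h * ℓ e.2 + r e.2) ∧
      ∀ σ ⊂ τ, 2 ≤ σ.card → (∃ e ∈ edges σ, ℓ e.1 < ℓ e.2) →
        (Fintype.card P : ℝ) ^ (2 * σ.card) < alpha σ (fun x => h * ℓ x + r x) := by
  have hL1 : 1 ≤ L := by
    obtain ⟨e, he, hlt⟩ := hcross
    have := hℓ _ (mem_edges.1 he).2.1
    omega
  have hcardτ : τ.card ≤ Fintype.card P := Finset.card_le_univ τ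
  have hn : (2 : ℝ) ≤ Fintype.card P := by
    exact_mod_cast (by omega : 2 ≤ Fintype.card P)
  have hLn : (L : ℝ) + 1 ≤ Fintype.card P := by exact_mod_cast hL.trans hcardτ
  set n : ℝ := (Fintype.card P : ℝ) with hndef
  set K := n ^ (2 * (τ.card - L)) with hK
  set M := n ^ (2 * (τ.card - 2)) with hM
  have hMpos : 0 < M := by positivity
  have hKpos : 0 < K := by positivity
  have hτM : n ^ (2 * τ.card) = n ^ 4 * M := by
    rw [hM, ← pow_add]; congr 1; omega
  have hedgeℓ : ∀ e ∈ edges τ, (0 : ℝ) ≤ (ℓ e.2 : ℝ) - ℓ e.1 ∧ (ℓ e.2 : ℝ) - ℓ e.1 ≤ L := by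
    intro e he
    have h1 : ℓ e.1 ≤ ℓ e.2 := by rcases hedge e he with h | h <;> omega
    have h2 := hℓ _ (mem_edges.1 he).2.1
    have h1' : (ℓ e.1 : ℝ) ≤ ℓ e.2 := by exact_mod_cast h1
    have h2' : (ℓ e.2 : ℝ) ≤ L := by exact_mod_cast h2
    have h3 : (0 : ℝ) ≤ ℓ e.1 := Nat.cast_nonneg _
    constructor <;> linarith
  have hℓpos : 0 < alpha τ (fun x => (ℓ x : ℝ)) := by
    obtain ⟨e, he, hlt⟩ := hcross
    have h1 := sub_le_alpha_of_mem_edges (p := fun x => (ℓ x : ℝ))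
      (fun e he => sub_nonneg.1 (hedgeℓ e he).1) he
    have h2 : (ℓ e.1 : ℝ) < ℓ e.2 := by exact_mod_cast hlt
    linarith
  -- The functional is linear, so `h` is the unique factor making `τ` tight.
  obtain ⟨h, hh⟩ : ∃ h : ℝ, h * alpha τ (fun x => (ℓ x : ℝ)) + alpha τ r = n ^ (2 * τ.card) :=
    ⟨(n ^ (2 * τ.card) - alpha τ r) / alpha τ (fun x => (ℓ x : ℝ)), by field_simp; ring⟩
  have hα : alpha τ (fun x => h * ℓ x + r x) = n ^ (2 * τ.card) := by
    rw [← hh, ← alphaLin_apply, ← alphaLin_apply, ← alphaLin_apply, ← smul_eq_mul, ← map_smul,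
      ← map_add]
    rfl
  have hlen : ∀ B, 0 ≤ B → h ≤ B → ∀ e ∈ edges τ,
      (h * ℓ e.2 + r e.2) - (h * ℓ e.1 + r e.1) ≤ L * B + K := by
    intro B hB0 hB e he
    obtain ⟨h1, h2⟩ := hedgeℓ e he
    have h3 := (hr _ (mem_edges.1 he).1).1
    have h4 := (hr _ (mem_edges.1 he).2.1).2
    nlinarith [mul_le_mul_of_nonneg_right hB h1, mul_le_mul_of_nonneg_left h2 hB0]
  have hhM : M + K < h := by
    by_contra! hle
    have h1 := alpha_le_of_forall_le (p := fun x => h * ℓ x + r x)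
      (hlen (M + K) (by positivity) hle)
    have h2 := two_mul_card_edges_le_card τ
    have h3 := mul_add_lt_of_pow (K := K) hn hMpos hL1 hLn
      (fun h => by rw [hK, hM, ← pow_add]; congr 1; omega)
      (fun h => by rw [hK, hM]; exact pow_le_pow_right₀ (by linarith) (by omega))
    have h4 : 0 ≤ L * (M + K) + K := by positivity
    rw [hα, hτM] at h1
    nlinarith [mul_le_mul_of_nonneg_right h2 h4]
  have hcrosslen : ∀ e ∈ edges τ, ℓ e.1 < ℓ e.2 →
      h - K ≤ (h * ℓ e.2 + r e.2) - (h * ℓ e.1 + r e.1) := by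
    intro e he hlt
    have h1 : (ℓ e.1 : ℝ) + 1 ≤ ℓ e.2 := by exact_mod_cast hlt
    have h3 := (hr _ (mem_edges.1 he).1).2
    have h4 := (hr _ (mem_edges.1 he).2.1).1
    have h5 : 0 ≤ h := by linarith
    nlinarith [mul_le_mul_of_nonneg_left h1 h5]
  have hpos : ∀ e ∈ edges τ, h * ℓ e.1 + r e.1 < h * ℓ e.2 + r e.2 := by
    intro e he
    rcases hedge e he with ⟨heq, hlt⟩ | hlt
    · rw [heq]; linarith
    · have := hcrosslen e he hlt
      linarith
  refine ⟨h, hα, hpos, fun σ hσ hσ2 ⟨e, he, hlt⟩ => ?_⟩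
  have hσcard := Finset.card_lt_card hσ
  have hlow : h - K ≤ alpha σ (fun x => h * ℓ x + r x) :=
    (hcrosslen e (edges_mono hσ.1 he) hlt).trans
      (sub_le_alpha_of_mem_edges (p := fun x => h * ℓ x + r x)
        (fun e he => (hpos e (edges_mono hσ.1 he)).le) he)
  -- A single edge between levels rises by at least `h - K > M`, enough if `σ` misses two points of
  -- `τ`. If it misses one, a small `alpha σ` would force `h` to be small, and the few edges at the
  -- missing point could not supply the rest of `alpha τ`.
  by_cases hσt : σ.card + 2 ≤ τ.card
  · have : n ^ (2 * σ.card) ≤ M := pow_le_pow_right₀ (by linarith) (by omega)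
    linarith
  · by_contra! hcon
    set M' := n ^ (2 * σ.card) with hM'
    have hτM' : n ^ (2 * τ.card) = n ^ 2 * M' := by
      rw [hM', ← pow_add]; congr 1; omega
    have hB : h ≤ M' + K := by linarith
    have h0 : 0 ≤ M' + K := by positivity
    have h1 := alpha_sub_le_of_card (p := fun x => h * ℓ x + r x) (by positivity) hσ.1
      (by omega) (hlen (M' + K) h0 hB)
    have hn3 : (3 : ℝ) ≤ n := by
      rw [hndef]; exact_mod_cast (by omega : 3 ≤ Fintype.card P)
    have h2 := mul_add_lt_of_pow_of_three_le (K := K) (M := M') hn3 (by positivity) hL1 hLn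
      (fun h => by rw [hK, hM']; congr 1; omega)
      (fun h => by
        rw [hK, hM', ← pow_add]; exact pow_le_pow_right₀ (by linarith) (by omega))
    rw [hα, hτM'] at h1
    linarith

end Scaling

/-! ### Contracting disjoint subsets to blocks -/

section Blocks

variable {P : Type*} {C : Finset (Finset P)} {c τ : Finset P} {x y z : P}

/-- The equivalence relation whose classes are the members of `C` and singletons. -/
def SameBlock (C : Finset (Finset P)) (x y : P) : Prop :=
  x = y ∨ ∃ c ∈ C, x ∈ c ∧ y ∈ c

open Classical in
/-- The class of `x` for `SameBlock C`, as a subset of `τ`. -/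
noncomputable def block (C : Finset (Finset P)) (τ : Finset P) (x : P) : Finset P :=
  {y ∈ τ | SameBlock C x y}

lemma SameBlock.symm (h : SameBlock C x y) : SameBlock C y x := by
  rcases h with rfl | ⟨c, hc, hx, hy⟩
  · exact Or.inl rfl
  · exact Or.inr ⟨c, hc, hy, hx⟩

lemma SameBlock.trans (hC : ∀ c ∈ C, ∀ d ∈ C, c = d ∨ Disjoint c d) (h : SameBlock C x y)
    (h' : SameBlock C y z) : SameBlock C x z := by
  rcases h with rfl | ⟨c, hc, hx, hy⟩
  · exact h'
  rcases h' with rfl | ⟨d, hd, hy', hz⟩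
  · exact Or.inr ⟨c, hc, hx, hy⟩
  rcases hC c hc d hd with rfl | h
  · exact Or.inr ⟨c, hc, hx, hz⟩
  · exact absurd hy' (Finset.disjoint_left.1 h hy)

lemma mem_block : y ∈ block C τ x ↔ y ∈ τ ∧ SameBlock C x y := by
  simp [block]

lemma block_eq_iff (hC : ∀ c ∈ C, ∀ d ∈ C, c = d ∨ Disjoint c d) (hy : y ∈ τ) :
    block C τ x = block C τ y ↔ SameBlock C x y := by
  constructor
  · intro h
    have : y ∈ block C τ x := by
      rw [h, mem_block]
      exact ⟨hy, Or.inl rfl⟩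
    exact (mem_block.1 this).2
  · intro h
    ext z
    simp only [mem_block, and_congr_right_iff]
    exact fun _ => ⟨h.symm.trans hC, h.trans hC⟩

/-- Contracting `c` alone already loses `|c| - 1` points. With `L + 1` blocks this reads `|c| ≤ |τ|
- L`, the exponent that `exists_stretch` allows for `r`. -/
lemma card_image_block_add_card_le [DecidableEq P]
    (hC : ∀ c ∈ C, ∀ d ∈ C, c = d ∨ Disjoint c d) (hc : c ∈ C) (hcτ : c ⊆ τ) :
    (τ.image (block C τ)).card + c.card ≤ τ.card + 1 := by
  have hsub : τ.image (block C τ) ⊆ insert c ((τ \ c).image (block C τ)) := by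
    intro b hb
    obtain ⟨x, hx, rfl⟩ := Finset.mem_image.1 hb
    by_cases hxc : x ∈ c
    · refine Finset.mem_insert.2 (Or.inl ?_)
      ext y
      rw [mem_block]
      constructor
      · rintro ⟨-, rfl | ⟨d, hd, hx, hy⟩⟩
        · exact hxc
        · rcases hC c hc d hd with rfl | h
          · exact hy
          · exact absurd hx (Finset.disjoint_left.1 h hxc)
      · exact fun hy => ⟨hcτ hy, Or.inr ⟨c, hc, hxc, hy⟩⟩
    · exact Finset.mem_insert_of_mem (Finset.mem_image_of_mem _ (Finset.mem_sdiff.2 ⟨hx, hxc⟩))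
  have h1 := (Finset.card_le_card hsub).trans (Finset.card_insert_le _ _)
  have h2 := Finset.card_image_le (s := τ \ c) (f := block C τ)
  rw [Finset.card_sdiff_of_subset hcτ] at h2
  have h3 := Finset.card_le_card hcτ
  omega

end Blocks

/-! ### Levels on the contracted order -/

section Levels

variable {P : Type*} [PartialOrder P] {C : Finset (Finset P)} {c τ : Finset P} {x y z : P}

/-- The preorder generated by the order of `P` and by identifying the points of each member
of `C`. -/
def BlockLE (C : Finset (Finset P)) : P → P → Prop :=
  Relation.ReflTransGen fun a b => a ≤ b ∨ ∃ c ∈ C, a ∈ c ∧ b ∈ c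

open Classical in
/-- The number of blocks strictly below the block of `x`. -/
noncomputable def level (C : Finset (Finset P)) (τ : Finset P) (x : P) : ℕ :=
  (({y ∈ τ | BlockLE C y x ∧ ¬ BlockLE C x y} : Finset P).image (block C τ)).card

lemma SameBlock.blockLE (h : SameBlock C x y) : BlockLE C x y := by
  rcases h with rfl | h
  · exact .refl
  · exact .single (Or.inr h)

/-- A generating path that uses some block can be recorded as a `≺`-chain from its first block `c`
to its last block `d`. -/
lemma BlockLE.le_or_exists (hC : ∀ c ∈ C, ∀ d ∈ C, c = d ∨ Disjoint c d) (h : BlockLE C x y) :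
    x ≤ y ∨ ∃ c ∈ C, ∃ d ∈ C, (∃ u ∈ c, x ≤ u) ∧ (∃ v ∈ d, v ≤ y) ∧
      Relation.ReflTransGen (fun σ ρ : Finset P => σ ∈ C ∧ ρ ∈ C ∧ TubeLT σ ρ) c d := by
  induction h with
  | refl => exact Or.inl le_rfl
  | @tail y z _ hyz ih =>
    rcases hyz with hyz | ⟨e, he, hy, hz⟩
    · rcases ih with h | ⟨c, hc, d, hd, hx, ⟨v, hv, hvy⟩, hcd⟩
      · exact Or.inl (h.trans hyz)
      · exact Or.inr ⟨c, hc, d, hd, hx, ⟨v, hv, hvy.trans hyz⟩, hcd⟩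
    · rcases ih with h | ⟨c, hc, d, hd, hx, ⟨v, hv, hvy⟩, hcd⟩
      · exact Or.inr ⟨e, he, e, he, ⟨y, hy, h⟩, ⟨z, hz, le_rfl⟩, .refl⟩
      · refine Or.inr ⟨c, hc, e, he, hx, ⟨z, hz, le_rfl⟩, ?_⟩
        rcases hC d hd e he with rfl | hde
        · exact hcd
        · have hne : v ≠ y := fun h => Finset.disjoint_left.1 hde hv (h ▸ hy)
          exact hcd.tail ⟨hd, he, hde, v, hv, y, hy, lt_of_le_of_ne hvy hne⟩

/-- Going from `x` to `y` and back closes up the chain of blocks, so acyclicity collapses it to a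
single tube, and convexity of that tube captures both points. With no blocks involved, antisymmetry
applies. -/
lemma BlockLE.sameBlock (hC : ∀ c ∈ C, ∀ d ∈ C, c = d ∨ Disjoint c d)
    (htube : ∀ c ∈ C, IsTube c)
    (hacyc : ∀ c, ¬ Relation.TransGen
      (fun σ ρ : Finset P => σ ∈ C ∧ ρ ∈ C ∧ TubeLT σ ρ) c c)
    (h : BlockLE C x y) (h' : BlockLE C y x) : SameBlock C x y := by
  set R := fun σ ρ : Finset P => σ ∈ C ∧ ρ ∈ C ∧ TubeLT σ ρ
  have hstep : ∀ c ∈ C, ∀ d ∈ C, ∀ u ∈ c, ∀ v ∈ d, u ≤ v → Relation.ReflTransGen R c d := by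
    intro c hc d hd u hu v hv huv
    rcases hC c hc d hd with rfl | hcd
    · exact .refl
    · have hne : u ≠ v := fun h => Finset.disjoint_left.1 hcd hu (h ▸ hv)
      exact .single ⟨hc, hd, hcd, u, hu, v, hv, lt_of_le_of_ne huv hne⟩
  have hanti : ∀ c d, Relation.ReflTransGen R c d → Relation.ReflTransGen R d c → c = d := by
    intro c d hcd hdc
    rcases Relation.reflTransGen_iff_eq_or_transGen.1 hcd with h | h
    · exact h.symm
    · exact absurd (Relation.TransGen.trans_left h hdc) (hacyc c)
  have hbetween : ∀ c ∈ C, ∀ u ∈ c, ∀ v ∈ c, ∀ z, u ≤ z → z ≤ v → z ∈ c := fun c hc u hu v hv z =>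
    (htube c hc).2.1 u hu v hv z
  rcases h.le_or_exists hC with hxy | ⟨c, hc, d, hd, ⟨u, hu, hxu⟩, ⟨v, hv, hvy⟩, hcd⟩
  · rcases h'.le_or_exists hC with hyx | ⟨c, hc, d, hd, ⟨u, hu, hyu⟩, ⟨v, hv, hvx⟩, hcd⟩
    · exact Or.inl (le_antisymm hxy hyx)
    · obtain rfl := hanti c d hcd (hstep d hd c hc v hv u hu (hvx.trans (hxy.trans hyu)))
      exact Or.inr ⟨c, hc, hbetween c hc v hv u hu x hvx (hxy.trans hyu),
        hbetween c hc v hv u hu y (hvx.trans hxy) hyu⟩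
  · rcases h'.le_or_exists hC with hyx | ⟨c', hc', d', hd', ⟨u', hu', hyu'⟩, ⟨v', hv', hvx'⟩, hcd'⟩
    · obtain rfl := hanti c d hcd (hstep d hd c hc v hv u hu (hvy.trans (hyx.trans hxu)))
      exact Or.inr ⟨c, hc, hbetween c hc v hv u hu x (hvy.trans hyx) hxu,
        hbetween c hc v hv u hu y hvy (hyx.trans hxu)⟩
    · have h1 := hstep d hd c' hc' v hv u' hu' (hvy.trans hyu')
      have h2 := hstep d' hd' c hc v' hv' u hu (hvx'.trans hxu)
      obtain rfl := hanti c d hcd (h1.trans (hcd'.trans h2))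
      obtain rfl := hanti c c' h1 (hcd'.trans h2)
      obtain rfl := hanti c d' hcd' h2
      exact Or.inr ⟨c, hc, hbetween c hc v' hv' u hu x hvx' hxu,
        hbetween c hc v hv u' hu' y hvy hyu'⟩

lemma level_eq_of_sameBlock (h : SameBlock C x y) : level C τ x = level C τ y := by
  have h1 := h.blockLE
  have h2 := h.symm.blockLE
  rw [level, level]
  congr 2
  ext z
  simp only [Finset.mem_filter, and_congr_right_iff]
  exact fun _ => and_congr ⟨fun h => h.trans h1, fun h => h.trans h2⟩
    (not_congr ⟨fun h => h2.trans h, fun h => h1.trans h⟩)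

lemma block_notMem_image (hC : ∀ c ∈ C, ∀ d ∈ C, c = d ∨ Disjoint c d) (hx : x ∈ τ) [DecidableEq P]
    [DecidablePred fun y => BlockLE C y x ∧ ¬ BlockLE C x y] :
    block C τ x ∉ ({y ∈ τ | BlockLE C y x ∧ ¬ BlockLE C x y} : Finset P).image (block C τ) := by
  intro h
  obtain ⟨z, hz, hzx⟩ := Finset.mem_image.1 h
  exact (Finset.mem_filter.1 hz).2.2 (((block_eq_iff hC hx).1 hzx).symm.blockLE)

/-- Blocks strictly below `x` are strictly below `y`, and the block of `x` is a new one. -/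
lemma level_lt_level (hC : ∀ c ∈ C, ∀ d ∈ C, c = d ∨ Disjoint c d)
    (htube : ∀ c ∈ C, IsTube c)
    (hacyc : ∀ c, ¬ Relation.TransGen
      (fun σ ρ : Finset P => σ ∈ C ∧ ρ ∈ C ∧ TubeLT σ ρ) c c)
    (hx : x ∈ τ) (hxy : x ≤ y) (hne : ¬ SameBlock C x y) : level C τ x < level C τ y := by
  classical
  have h1 : BlockLE C x y := .single (Or.inl hxy)
  have h2 : ¬ BlockLE C y x := fun h => hne (h1.sameBlock hC htube hacyc h)
  refine Finset.card_lt_card (Finset.ssubset_iff_subset_ne.2 ⟨Finset.image_subset_image ?_, ?_⟩)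
  · intro z hz
    rw [Finset.mem_filter] at hz ⊢
    exact ⟨hz.1, hz.2.1.trans h1, fun h => hz.2.2 (h1.trans h)⟩
  · intro h
    refine block_notMem_image hC hx (h ▸ ?_)
    exact Finset.mem_image_of_mem _ (Finset.mem_filter.2 ⟨hx, h1, h2⟩)

lemma level_lt_card [DecidableEq P] (hC : ∀ c ∈ C, ∀ d ∈ C, c = d ∨ Disjoint c d) (hx : x ∈ τ) :
    level C τ x < (τ.image (block C τ)).card := by
  classical
  rw [level]
  refine lt_of_le_of_lt (le_of_eq ?_) (Finset.card_lt_card (Finset.ssubset_iff_subset_ne.2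
    ⟨Finset.image_subset_image (Finset.filter_subset
      (fun y => BlockLE C y x ∧ ¬ BlockLE C x y) τ), ?_⟩))
  · congr!
  · intro h
    exact block_notMem_image hC hx (h ▸ Finset.mem_image_of_mem _ hx)

/-- Otherwise connectivity would put all of `σ` in one block, which has at least two points and so
is a member of `C`. -/
lemma exists_edge_not_sameBlock {σ : Finset P}
    (hC : ∀ c ∈ C, ∀ d ∈ C, c = d ∨ Disjoint c d) (hσ : IsTube σ) (h : ∀ c ∈ C, ¬ σ ⊆ c) :
    ∃ e ∈ edges σ, ¬ SameBlock C e.1 e.2 := by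
  by_contra! hcon
  obtain ⟨x, hx, y, hy, hxy⟩ := Finset.one_lt_card.1 hσ.2.2
  have hall : ∀ z ∈ σ, SameBlock C x z := fun z hz =>
    (iff_of_preconnected (Q := fun z => SameBlock C x z) hσ.1.preconnected (fun i hi j hj hij => by
      have := hcon (i, j) (mem_edges.2 ⟨hi, hj, hij⟩)
      exact ⟨fun h => h.trans hC this, fun h => h.trans hC this.symm⟩) hx hz).1 (Or.inl rfl)
  obtain ⟨c, hc, hxc, -⟩ := (hall y hy).resolve_left hxy
  refine h c hc fun z hz => ?_
  rcases hall z hz with rfl | ⟨d, hd, hxd, hzd⟩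
  · exact hxc
  · rcases hC c hc d hd with rfl | hcd
    · exact hzd
    · exact absurd hxd (Finset.disjoint_left.1 hcd hxc)

end Levels

/-! ### Maximal smaller tubes of a laminar family -/

section Children

variable {P : Type*} {S : Finset (Finset P)}

open Classical in
/-- The maximal members of `S` that are strictly contained in `τ`. -/
noncomputable def children (S : Finset (Finset P)) (τ : Finset P) : Finset (Finset P) :=
  {σ ∈ S | σ ⊂ τ ∧ ∀ ρ ∈ S, σ ⊂ ρ → ¬ ρ ⊂ τ}

lemma mem_children {σ τ : Finset P} :
    σ ∈ children S τ ↔ σ ∈ S ∧ σ ⊂ τ ∧ ∀ ρ ∈ S, σ ⊂ ρ → ¬ ρ ⊂ τ := by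
  simp [children]

lemma exists_mem_children {σ τ : Finset P} (hσ : σ ∈ S) (hστ : σ ⊂ τ) :
    ∃ c ∈ children S τ, σ ⊆ c := by
  classical
  obtain ⟨c, hc, hmax⟩ := Finset.exists_max_image ({ρ ∈ S | σ ⊆ ρ ∧ ρ ⊂ τ} : Finset (Finset P))
    Finset.card ⟨σ, by simp [hσ, hστ]⟩
  rw [Finset.mem_filter] at hc
  refine ⟨c, mem_children.2 ⟨hc.1, hc.2.2, fun ρ hρ hcρ hρτ => ?_⟩, hc.2.1⟩
  have h1 := hmax ρ (Finset.mem_filter.2 ⟨hρ, hc.2.1.trans hcρ.1, hρτ⟩)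
  exact h1.not_gt (Finset.card_lt_card hcρ)

lemma children_eq_or_disjoint {τ : Finset P}
    (hlam : ∀ σ ∈ S, ∀ ρ ∈ S, σ ⊆ ρ ∨ ρ ⊆ σ ∨ Disjoint σ ρ) :
    ∀ c ∈ children S τ, ∀ d ∈ children S τ, c = d ∨ Disjoint c d := by
  intro c hc d hd
  rw [mem_children] at hc hd
  rcases hlam c hc.1 d hd.1 with h | h | h
  · rcases h.eq_or_ssubset with h | h
    · exact Or.inl h
    · exact absurd hd.2.1 (hc.2.2 d hd.1 h)
  · rcases h.eq_or_ssubset with h | h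
    · exact Or.inl h.symm
    · exact absurd hc.2.1 (hd.2.2 c hc.1 h)
  · exact Or.inr h

end Children

/-! ### Realizing a tubing by recursion on tubes -/

section Construction

variable {P : Type*} [PartialOrder P] [Fintype P] {S : Finset (Finset P)}

/-- A nonnegative function of spread at most `n ^ (2|τ|)` on the tube `τ` for which the tubes inside
`τ` that are tight are those in `S`. -/
def IsRealizedBy (S : Finset (Finset P)) (τ : Finset P) (q : P → ℝ) : Prop :=
  (∀ x ∈ τ, 0 ≤ q x ∧ q x ≤ (Fintype.card P : ℝ) ^ (2 * τ.card)) ∧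
    (∀ e ∈ edges τ, q e.1 < q e.2) ∧
    (∀ σ ∈ S, σ ⊆ τ → alpha σ q = (Fintype.card P : ℝ) ^ (2 * σ.card)) ∧
    ∀ σ, IsTube σ → σ ⊆ τ → σ ∉ S → (Fintype.card P : ℝ) ^ (2 * σ.card) < alpha σ q

lemma exists_isRealizedBy (htube : ∀ σ ∈ S, IsTube σ)
    (hlam : ∀ σ ∈ S, ∀ ρ ∈ S, σ ⊆ ρ ∨ ρ ⊆ σ ∨ Disjoint σ ρ)
    (hacyc : ∀ τ, ¬ Relation.TransGen
      (fun σ ρ : Finset P => σ ∈ S ∧ ρ ∈ S ∧ TubeLT σ ρ) τ τ) (τ : Finset P) (hτ : τ ∈ S) :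
    ∃ q, IsRealizedBy S τ q := by
  classical
  induction τ using Finset.strongInduction with
  | H τ ih =>
  have hC := children_eq_or_disjoint (τ := τ) hlam
  set C := children S τ with hCdef
  have hCS : ∀ c ∈ C, c ∈ S ∧ c ⊂ τ := fun c hc =>
    ⟨(mem_children.1 hc).1, (mem_children.1 hc).2.1⟩
  have hCtube : ∀ c ∈ C, IsTube c := fun c hc => htube c (hCS c hc).1
  have hCacyc : ∀ c, ¬ Relation.TransGen
      (fun σ ρ : Finset P => σ ∈ C ∧ ρ ∈ C ∧ TubeLT σ ρ) c c := fun c h =>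
    hacyc c (Relation.TransGen.mono (fun σ ρ h => ⟨(hCS _ h.1).1, (hCS _ h.2.1).1, h.2.2⟩) _ _ h)
  have hτtube := htube τ hτ
  have hQ : ∀ c ∈ C, ∃ q, IsRealizedBy S c q := fun c hc => ih c (hCS c hc).2 (hCS c hc).1
  choose! Q hQ using hQ
  -- Glue the functions of the children; points outside all of them get the value `0`.
  let r : P → ℝ := fun x => if h : ∃ c ∈ C, x ∈ c then Q h.choose x else 0
  have hrC : ∀ c ∈ C, ∀ x ∈ c, r x = Q c x := by
    intro c hc x hx
    have h : ∃ c ∈ C, x ∈ c := ⟨c, hc, hx⟩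
    have heq : h.choose = c := by
      rcases hC _ h.choose_spec.1 c hc with h' | h'
      · exact h'
      · exact absurd hx (Finset.disjoint_left.1 h' h.choose_spec.2)
    simp only [r, dif_pos h, heq]
  have hn1 : (1 : ℝ) ≤ Fintype.card P := by
    obtain ⟨x, -⟩ := hτtube.nonempty
    have : Nonempty P := ⟨x⟩
    exact_mod_cast Fintype.card_pos (α := P)
  obtain ⟨e₀, he₀, hne₀⟩ := exists_edge_not_sameBlock hC hτtube
    fun c hc h => (hCS c hc).2.2 h
  set m := (τ.image (block C τ)).card with hm
  have hm_le : m ≤ τ.card := Finset.card_image_le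
  have hlt : ∀ e ∈ edges τ, ¬ SameBlock C e.1 e.2 → level C τ e.1 < level C τ e.2 := fun e he hne =>
    level_lt_level hC hCtube hCacyc (mem_edges.1 he).1 (mem_edges.1 he).2.2.le hne
  have hlevel : ∀ x ∈ τ, level C τ x < m := fun x hx => level_lt_card hC hx
  have hm_pos : 0 < m := lt_of_le_of_lt (Nat.zero_le _) (hlevel _ (mem_edges.1 he₀).1)
  have hr : ∀ x ∈ τ, 0 ≤ r x ∧ r x ≤ (Fintype.card P : ℝ) ^ (2 * (τ.card - (m - 1))) := by
    intro x hx
    by_cases h : ∃ c ∈ C, x ∈ c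
    · obtain ⟨c, hc, hxc⟩ := h
      rw [hrC c hc x hxc]
      obtain ⟨h1, h2⟩ := (hQ c hc).1 x hxc
      refine ⟨h1, h2.trans (pow_le_pow_right₀ hn1 ?_)⟩
      have := card_image_block_add_card_le hC hc (hCS c hc).2.1
      omega
    · simp only [r, dif_neg h]
      exact ⟨le_rfl, by positivity⟩
  -- Levels are smaller than the number `m` of blocks, hence `L = m - 1`.
  obtain ⟨h, hα, hpos, hlarge⟩ := exists_stretch (τ := τ) (ℓ := level C τ) (r := r) (L := m - 1)
    (by omega) (fun x hx => by have := hlevel x hx; omega) hr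
    (fun e he => by
      by_cases hsame : SameBlock C e.1 e.2
      · refine Or.inl ⟨level_eq_of_sameBlock hsame, ?_⟩
        obtain ⟨h1, h2, h3⟩ := mem_edges.1 he
        obtain ⟨c, hc, hc1, hc2⟩ := hsame.resolve_left h3.ne
        rw [hrC c hc _ hc1, hrC c hc _ hc2]
        exact (hQ c hc).2.1 e (mem_edges.2 ⟨hc1, hc2, h3⟩)
      · exact Or.inr (hlt e he hsame)) ⟨e₀, he₀, hlt e₀ he₀ hne₀⟩
  set q : P → ℝ := fun x => h * level C τ x + r x with hq
  -- The level is constant on a child, so there `q` is a translate of `Q c`.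
  have hqC : ∀ c ∈ C, ∀ σ ⊆ c, alpha σ q = alpha σ (Q c) := by
    intro c hc σ hσ
    rcases σ.eq_empty_or_nonempty with rfl | ⟨y, hy⟩
    · simp [alpha]
    · refine alpha_congr (k := h * level C τ y) fun x hx => ?_
      simp only [hq]
      rw [hrC c hc x (hσ hx),
        level_eq_of_sameBlock (C := C) (x := x) (y := y) (Or.inr ⟨c, hc, hσ hx, hσ hy⟩)]
      ring
  -- Translate the minimum to `0`: the spread is at most `alpha τ q`, which gives the upper bound
  -- that the recursion needs.
  obtain ⟨z, hz, hzmin⟩ := Finset.exists_min_image τ q hτtube.nonempty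
  have hshift : ∀ σ : Finset P, alpha σ (fun x => q x + -q z) = alpha σ q := fun σ =>
    alpha_congr fun x _ => rfl
  refine ⟨fun x => q x + -q z, fun x hx => ⟨?_, ?_⟩, fun e he => ?_, fun σ hσ hστ => ?_,
    fun σ hσ hστ hσS => ?_⟩
  · have := hzmin x hx
    linarith
  · have := sub_le_alpha (p := q) hτtube.1 (fun e he => (hpos e he).le) hz hx
    rw [hα] at this
    linarith
  · have := hpos e he
    simp only [hq]
    linarith
  · rw [hshift]
    rcases hστ.eq_or_ssubset with rfl | hss
    · exact hα
    · obtain ⟨c, hc, hσc⟩ := exists_mem_children hσ hss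
      rw [hqC c hc σ hσc]
      exact (hQ c hc).2.2.1 σ hσ hσc
  · rw [hshift]
    by_cases hin : ∃ c ∈ C, σ ⊆ c
    · obtain ⟨c, hc, hσc⟩ := hin
      rw [hqC c hc σ hσc]
      exact (hQ c hc).2.2.2 σ hσ hσc hσS
    · push Not at hin
      obtain ⟨e, he, hne⟩ := exists_edge_not_sameBlock hC hσ hin
      exact hlarge σ (hστ.ssubset_of_ne fun h => hσS (h ▸ hτ)) hσ.2.2
        ⟨e, he, hlt e (edges_mono hστ he) hne⟩

end Construction

/-! ### The realization as a polyhedron -/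

section Realization

variable {P : Type*} [PartialOrder P] [Fintype P]

lemma IsProperTubing.mono {T T' : Finset (Finset P)} (hT : IsProperTubing T) (h : T' ⊆ T) :
    IsProperTubing T' :=
  ⟨fun τ hτ => hT.1 τ (h hτ), fun σ hσ τ hτ => hT.2.1 σ (h hσ) τ (h hτ), fun τ hcyc =>
    hT.2.2 τ (Relation.TransGen.mono (fun _ _ hR => ⟨h hR.1, h hR.2.1, hR.2.2⟩) _ _ hcyc)⟩

lemma mem_realization {p : P → ℝ} :
    p ∈ realization P ↔ ∑ i, p i = 0 ∧
      alpha Finset.univ p = (Fintype.card P : ℝ) ^ (2 * Fintype.card P) ∧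
      ∀ τ, IsProperTube τ → (Fintype.card P : ℝ) ^ (2 * τ.card) ≤ alpha τ p := by
  have hz : p ∈ zeroSum P ↔ ∑ i, p i = 0 := by simp [zeroSum, LinearMap.mem_ker]
  simp only [realization, hyperplane, halfSpace, Set.mem_inter_iff, Set.mem_iInter,
    Set.mem_ofPred_eq, hz, Finset.card_univ]
  constructor
  · rintro ⟨⟨h1, h2⟩, h3⟩
    exact ⟨h1, h2, fun τ hτ => (h3 τ hτ).2⟩
  · rintro ⟨h1, h2, h3⟩
    exact ⟨⟨h1, h2⟩, fun τ hτ => ⟨h1, h3 τ hτ⟩⟩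

lemma isProperTube_or_eq_univ {σ : Finset P} (hσ : IsTube σ) :
    IsProperTube σ ∨ σ = Finset.univ := by
  rcases (Finset.card_le_univ σ).lt_or_eq with h | h
  · exact Or.inl ⟨hσ, h⟩
  · exact Or.inr (Finset.card_eq_iff_eq_univ σ |>.1 h)

lemma pow_le_alpha_of_mem_realization {p : P → ℝ} (hp : p ∈ realization P) (σ : Finset P)
    (hσ : IsTube σ) : (Fintype.card P : ℝ) ^ (2 * σ.card) ≤ alpha σ p := by
  rw [mem_realization] at hp
  rcases isProperTube_or_eq_univ hσ with h | rfl
  · exact hp.2.2 σ h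
  · rw [hp.2.1, Finset.card_univ]

lemma isBounded_realization (hconn : (SimpleGraph.hasse P).Connected)
    (hcard : 2 ≤ Fintype.card P) : Bornology.IsBounded (realization P) := by
  set N := (Fintype.card P : ℝ) ^ (2 * Fintype.card P) with hN
  refine (Metric.isBounded_Icc (fun _ : P => -N) (fun _ : P => N)).subset fun p hp => ?_
  have hmono := strictMono_of_forall_tube (pow_le_alpha_of_mem_realization hp)
  have hsub : ∀ x y, p y - p x ≤ N := fun x y => by
    have := sub_le_alpha (isTube_univ hconn hcard).1
      (fun e he => (hmono (mem_edges.1 he).2.2.lt).le) (Finset.mem_univ x) (Finset.mem_univ y)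
    rwa [(mem_realization.1 hp).2.1] at this
  have hsum := (mem_realization.1 hp).1
  have hne : (Finset.univ : Finset P).Nonempty := (isTube_univ hconn hcard).nonempty
  have hpos : (0 : ℝ) < Fintype.card P := by exact_mod_cast (by omega : 0 < Fintype.card P)
  refine ⟨fun x => ?_, fun x => ?_⟩
  -- Sum over `y`: the values of `p` add up to `0`, so only `-n * p x ≤ n * N` remains.
  · have h := Finset.sum_le_sum fun y (_ : y ∈ Finset.univ) => hsub x y
    simp only [Finset.sum_sub_distrib, hsum, Finset.sum_const, Finset.card_univ, nsmul_eq_mul] at h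
    nlinarith
  · have h := Finset.sum_le_sum fun y (_ : y ∈ Finset.univ) => hsub y x
    simp only [Finset.sum_sub_distrib, hsum, Finset.sum_const, Finset.card_univ, nsmul_eq_mul] at h
    nlinarith

open Classical in
variable (P) in
/-- The proper tubes of `P`. -/
noncomputable def properTubes : Finset (Finset P) :=
  {τ | IsProperTube τ}

lemma mem_properTubes {τ : Finset P} : τ ∈ properTubes P ↔ IsProperTube τ := by
  simp [properTubes]

variable (P) in
/-- The linear functionals of the equations of the realization. -/
noncomputable def equationLin : Fin 2 → (P → ℝ) →ₗ[ℝ] ℝ :=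
  ![∑ i, LinearMap.proj i, alphaLin Finset.univ]

lemma realization_eq_polyhedron : realization P = polyhedron (equationLin P)
    ![0, (Fintype.card P : ℝ) ^ (2 * Fintype.card P)] alphaLin
    (fun τ => (Fintype.card P : ℝ) ^ (2 * τ.card)) (properTubes P) := by
  ext p
  rw [mem_realization]
  simp [polyhedron, Fin.forall_fin_two, equationLin, alphaLin_apply, mem_properTubes, and_assoc]

lemma isProperTubing_tightSet (hcard : 2 ≤ Fintype.card P) {p : P → ℝ} (hp : p ∈ realization P) :
    IsProperTubing (tightSet alphaLin (fun τ : Finset P => (Fintype.card P : ℝ) ^ (2 * τ.card))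
      (properTubes P) p) := by
  have hle := pow_le_alpha_of_mem_realization hp
  have hmem : ∀ τ ∈ tightSet alphaLin (fun τ : Finset P => (Fintype.card P : ℝ) ^ (2 * τ.card))
      (properTubes P) p, IsProperTube τ ∧ alpha τ p = (Fintype.card P : ℝ) ^ (2 * τ.card) := by
    intro τ hτ
    rwa [mem_tightSet, alphaLin_apply, mem_properTubes] at hτ
  exact ⟨fun τ hτ => (hmem τ hτ).1, fun σ hσ τ hτ => nested_or_disjoint_of_alpha_eq hcard hle
      (hmem σ hσ).1.1 (hmem τ hτ).1.1 (hmem σ hσ).2 (hmem τ hτ).2,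
    acyclic_of_alpha_eq hcard hle (fun τ hτ => (hmem τ hτ).1.1) fun τ hτ => (hmem τ hτ).2⟩

/-- Apply the recursion to `T` with `P` added, at the tube `P`. This creates no cycle, since `P` is
disjoint from no tube. A translation then makes the sum zero without changing any `alpha`. -/
lemma exists_tightSet_eq (hconn : (SimpleGraph.hasse P).Connected) (hcard : 2 ≤ Fintype.card P)
    {T : Finset (Finset P)} (hT : IsProperTubing T) :
    ∃ p ∈ realization P, tightSet alphaLin
      (fun τ : Finset P => (Fintype.card P : ℝ) ^ (2 * τ.card)) (properTubes P) p = T := by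
  classical
  have huniv := isTube_univ hconn hcard
  have htube : ∀ σ ∈ insert Finset.univ T, IsTube σ := by
    intro σ hσ
    rcases Finset.mem_insert.1 hσ with rfl | hσ
    · exact huniv
    · exact (hT.1 σ hσ).1
  have hR : ∀ σ ρ : Finset P, σ ∈ insert Finset.univ T → ρ ∈ insert Finset.univ T → TubeLT σ ρ →
      σ ∈ T ∧ ρ ∈ T ∧ TubeLT σ ρ := by
    intro σ ρ hσ hρ h
    obtain ⟨hdisj, a, ha, b, hb, -⟩ := id h
    refine ⟨(Finset.mem_insert.1 hσ).resolve_left ?_, (Finset.mem_insert.1 hρ).resolve_left ?_, h⟩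
    · rintro rfl
      exact Finset.disjoint_left.1 hdisj (Finset.mem_univ b) hb
    · rintro rfl
      exact Finset.disjoint_left.1 hdisj ha (Finset.mem_univ a)
  obtain ⟨q, -, -, heq, hlt⟩ := exists_isRealizedBy htube (fun σ hσ ρ hρ => by
    rcases Finset.mem_insert.1 hσ with rfl | hσ
    · exact Or.inr (Or.inl (Finset.subset_univ _))
    rcases Finset.mem_insert.1 hρ with rfl | hρ
    · exact Or.inl (Finset.subset_univ _)
    · exact hT.2.1 σ hσ ρ hρ)
    (fun τ hcyc => hT.2.2 τ
      (Relation.TransGen.mono (fun σ ρ h => hR σ ρ h.1 h.2.1 h.2.2) _ _ hcyc))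
    Finset.univ (Finset.mem_insert_self _ _)
  have hpos : (Fintype.card P : ℝ) ≠ 0 := by exact_mod_cast (by omega : Fintype.card P ≠ 0)
  set p : P → ℝ := fun x => q x + -((∑ i, q i) / Fintype.card P) with hp
  have hα : ∀ σ : Finset P, alpha σ p = alpha σ q := fun σ => alpha_congr fun x _ => rfl
  have htight : ∀ σ, IsProperTube σ →
      (σ ∈ T ∧ alpha σ p = (Fintype.card P : ℝ) ^ (2 * σ.card)) ∨
      (σ ∉ T ∧ (Fintype.card P : ℝ) ^ (2 * σ.card) < alpha σ p) := by
    intro σ hσ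
    rw [hα]
    by_cases hσT : σ ∈ T
    · exact Or.inl ⟨hσT, heq σ (Finset.mem_insert_of_mem hσT) (Finset.subset_univ σ)⟩
    · refine Or.inr ⟨hσT, hlt σ hσ.1 (Finset.subset_univ σ) fun h => hσT ?_⟩
      refine (Finset.mem_insert.1 h).resolve_left ?_
      rintro rfl
      exact hσ.2.ne Finset.card_univ
  refine ⟨p, mem_realization.2 ⟨?_, ?_, fun τ hτ => ?_⟩, ?_⟩
  · rw [hp, Finset.sum_add_distrib, Finset.sum_const, Finset.card_univ, nsmul_eq_mul]
    field_simp
    ring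
  · rw [hα, heq _ (Finset.mem_insert_self _ _) le_rfl, Finset.card_univ]
  · rcases htight τ hτ with h | h
    · exact h.2.ge
    · exact h.2.le
  · ext τ
    rw [mem_tightSet, alphaLin_apply, mem_properTubes]
    constructor
    · rintro ⟨h1, h2⟩
      rcases htight τ h1 with h | h
      · exact h.1
      · exact absurd h2 h.2.ne'
    · intro hτ
      refine ⟨hT.1 τ hτ, ?_⟩
      rcases htight τ (hT.1 τ hτ) with h | h
      · exact h.2
      · exact absurd hτ h.1

/-- Constants have nonzero sum and zero `alpha`; a point of the realization has zero sum and nonzero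
`alpha` on `P`. So the two equations are independent. -/
lemma surjective_pi_equationLin (hne : (realization P).Nonempty) (hcard : 2 ≤ Fintype.card P) :
    Function.Surjective (LinearMap.pi (equationLin P)) := by
  obtain ⟨p, hp⟩ := hne
  obtain ⟨h1, h2, -⟩ := mem_realization.1 hp
  have hpos : (Fintype.card P : ℝ) ≠ 0 := by exact_mod_cast (by omega : Fintype.card P ≠ 0)
  intro a
  refine ⟨(a 0 / Fintype.card P) • (fun _ => 1) +
    (a 1 / (Fintype.card P : ℝ) ^ (2 * Fintype.card P)) • p, ?_⟩
  have h3 : alpha Finset.univ (fun _ : P => (1 : ℝ)) = 0 := by simp [alpha]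
  ext j
  simp only [LinearMap.pi_apply, map_add, map_smul]
  fin_cases j
  · simp [equationLin, h1, hpos]
  · simp [equationLin, alphaLin_apply, h2, h3, hpos]

end Realization

end PosetAssociahedron

theorem theorem2p3 {P : Type*} [PartialOrder P] [Fintype P]
    (hconn : (SimpleGraph.hasse P).Connected) (hcard : 2 ≤ Fintype.card P) :
    PosetAssociahedron.IsSimplePolytope (PosetAssociahedron.realization P) ∧
      (PosetAssociahedron.realization P).Nonempty ∧
      PosetAssociahedron.affDim (PosetAssociahedron.realization P) + 2 = Fintype.card P ∧
      Nonempty (PosetAssociahedron.Faces (PosetAssociahedron.realization P) ≃o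
        (PosetAssociahedron.ProperTubing P)ᵒᵈ) := by
  open PosetAssociahedron in
  have hex := fun T (hT : IsProperTubing T) => exists_tightSet_eq hconn hcard hT
  have htight := fun p (hp : p ∈ realization P) => isProperTubing_tightSet hcard hp
  have hempty : IsProperTubing (∅ : Finset (Finset P)) := by
    refine ⟨by simp, by simp, fun τ h => ?_⟩
    obtain ⟨_, h, -⟩ := Relation.TransGen.head'_iff.1 h
    simp at h
  have hne : (realization P).Nonempty := by
    obtain ⟨p, hp, -⟩ := hex ∅ hempty
    exact ⟨p, hp⟩
  have hsurj := surjective_pi_equationLin hne hcard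
  have hbdd := isBounded_realization hconn hcard
  have hsub : ∀ T T' : Finset (Finset P), IsProperTubing T → T' ⊆ T → IsProperTubing T' :=
    fun T T' hT h => hT.mono h
  refine ⟨?_, hne, ?_, ?_⟩
  · rw [realization_eq_polyhedron] at *
    exact isSimplePolytope_polyhedron hbdd hsub htight hex hsurj
  · rw [realization_eq_polyhedron] at *
    have := affDim_tightFace hsub hex hsurj hempty
    rwa [tightFace_empty, Finset.card_empty, Fintype.card_fin, add_zero] at this
  · rw [realization_eq_polyhedron] at *
    exact nonempty_faces_orderIso htight hex
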